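/- Let $G$ be a semisimple Lie group with Lie algebra $\mathfrak g$ and Killing form $B$, acting smoothly, transitively and almost effectively (i.e. with discrete kernel) on a compact manifold $M$; fix $o\in M$, let $K$ be the isotropy subgroup of $o$, with Lie algebra $\mathfrak k$, so that $M=G/K$ as a homogeneous space, with projection $\pi:G\to M$, $\pi(a)=a\cdot o$ (a submersion). Assume that $M=G/K$ is a generalized Wallach space: there is a decomposition $$\mathfrak g=\mathfrak k\oplus\mathfrak m,\qquad \mathfrak m=\mathfrak m_1\oplus\mathfrak m_2\oplus\mathfrak m_3,$$ with $\mathfrak k,\mathfrak m_1,\mathfrak m_2,\mathfrak m_3$ pairwise $B$-orthogonal, each $\mathfrak m_i$ being $\operatorname{Ad}(K)$-invariant and irreducible, and $[\mathfrak m_i,\mathfrak m_i]\subset\mathfrak k$ for $i=1,2,3$. Let $\lambda_2,\lambda_3>0$ and let $g$ be the diagonal metric $(1,\lambda_2,\lambda_3)$, that is, the $G$-invariant Riemannian metric on $M$ which at $o$, under the identification $d\pi_e:\mathfrak m\cong T_oM$, is the inner product $$(-B)|_{\mathfrak m_1}+\lambda_2(-B)|_{\mathfrak m_2}+\lambda_3(-B)|_{\mathfrak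 m_3}.$$ Suppose that $[\mathfrak m_i,\mathfrak m_j]=0$ for some $i\neq j$. Then $(M,g)$ is a geodesic orbit space: for every geodesic $\gamma:J\to M$ on an open interval $J\ni 0$ there is $Y\in\mathfrak g$ with $\gamma(t)=\exp(tY)\cdot\gamma(0)$ for all $t\in J$. More precisely, for every $X\in\mathfrak m$ the curve $t\mapsto\exp(tX)\cdot o$, $t\in\mathbb R$, is a geodesic through $o$ with initial velocity $X$ (that is, $d\pi_e(X)$), and every geodesic $\gamma:J\to M$ on an open interval $J\ni 0$ with $\gamma(0)=o$ and $\dot\gamma(0)=X$ satisfies $\gamma(t)=\exp(tX)\cdot o$ for all $t\in J$. -/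

import Mathlib

open scoped Manifold ContDiff

noncomputable section

/-! ### Lie groups: exponential map and adjoint representation

The Lie algebra of `G` is Mathlib's `GroupLieAlgebra 𝓘(ℝ, E) G`: the tangent space at `1` with the
bracket of left invariant vector fields. -/

/-- Over `ℝ`, a smooth Lie group has the regularity that Mathlib needs for its Lie algebra. -/
instance leInfty_minSmoothness_real_three : ENat.LEInfty (minSmoothness ℝ 3) where
  out := by
    rw [minSmoothness_of_isRCLikeNormedField]
    exact WithTop.coe_le_coe.2 le_top

section LieGroup

variable {E : Type*} [NormedAddCommGroup E] [NormedSpace ℝ E]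
  {G : Type*} [TopologicalSpace G] [ChartedSpace E G] [Group G]

/-- `α : ℝ → G` is the (smooth) one-parameter subgroup with initial velocity `X`. -/
structure IsOneParameterSubgroup (X : GroupLieAlgebra 𝓘(ℝ, E) G) (α : ℝ → G) : Prop where
  smooth : ContMDiff 𝓘(ℝ, ℝ) 𝓘(ℝ, E) ∞ α
  map_add : ∀ s t : ℝ, α (s + t) = α s * α t
  velocity : (mfderiv 𝓘(ℝ, ℝ) 𝓘(ℝ, E) α 0 (1 : ℝ) : E) = X

open Classical in
/-- The exponential map of a Lie group: `exp X = α 1`, where `α` is the one-parameter subgroup with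
initial velocity `X`. (In a Lie group `α` exists and is unique, so the `else` branch is void.) -/
def lieExp (X : GroupLieAlgebra 𝓘(ℝ, E) G) : G :=
  if h : ∃ α : ℝ → G, IsOneParameterSubgroup X α then h.choose 1 else 1

/-- The adjoint representation `Ad a`, the differential at `1` of `b ↦ a b a⁻¹`. -/
def adjointRep (a : G) : GroupLieAlgebra 𝓘(ℝ, E) G →L[ℝ] GroupLieAlgebra 𝓘(ℝ, E) G :=
  (mfderiv 𝓘(ℝ, E) 𝓘(ℝ, E) (fun b : G => a * b * a⁻¹) 1 : E →L[ℝ] E)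

end LieGroup

/-! ### Riemannian manifolds: geodesics -/

section Geodesic

variable {F : Type*} [NormedAddCommGroup F] [NormedSpace ℝ F]
  {M : Type*} [TopologicalSpace M] [ChartedSpace F M] [IsManifold 𝓘(ℝ, F) ∞ M]

variable (F M) in
/-- Smooth Riemannian metrics on the manifold `M`. -/
abbrev SmoothMetric :=
  Bundle.ContMDiffRiemannianMetric 𝓘(ℝ, F) ∞ F (fun p : M => TangentSpace 𝓘(ℝ, F) p)

/-- The coefficient `g(u, v)` at the coordinate `y`, in the preferred chart at `x`, of a metric, for
constant vectors `u`, `v` of the model space. -/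
def metricInChart (g : SmoothMetric F M) (x : M) (y u v : F) : ℝ :=
  g.inner ((extChartAt 𝓘(ℝ, F) x).symm y)
    (mfderiv 𝓘(ℝ, F) 𝓘(ℝ, F) (extChartAt 𝓘(ℝ, F) x).symm y u)
    (mfderiv 𝓘(ℝ, F) 𝓘(ℝ, F) (extChartAt 𝓘(ℝ, F) x).symm y v)

/-- The Christoffel symbols of the first kind `Γ(u, v; w) = g(∇_u v, w)` of the Levi-Civita
connection in the preferred chart at `x`, given by the Koszul formula for constant vector fields:
`½ (∂_u g(v, w) + ∂_v g(u, w) - ∂_w g(u, v))`. -/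
def christoffelInChart (g : SmoothMetric F M) (x : M) (y u v w : F) : ℝ :=
  (1 / 2 : ℝ) * (fderiv ℝ (fun z => metricInChart g x z v w) y u
    + fderiv ℝ (fun z => metricInChart g x z u w) y v
    - fderiv ℝ (fun z => metricInChart g x z u v) y w)

/-- `γ` is a geodesic on the open set `J` of times: it is smooth on `J` and, in local coordinates
`c = φ ∘ γ`, satisfies `∇_γ' γ' = 0`, that is, `g(c'', w) + Γ(c', c'; w) = 0` for all `w`. -/
structure IsGeodesicOn (g : SmoothMetric F M) (γ : ℝ → M) (J : Set ℝ) : Prop where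
  smooth : ContMDiffOn 𝓘(ℝ, ℝ) 𝓘(ℝ, F) ∞ γ J
  equation : ∀ x : M, ∀ t ∈ J, γ t ∈ (chartAt F x).source → ∀ w : F,
    let c : ℝ → F := fun s => extChartAt 𝓘(ℝ, F) x (γ s)
    metricInChart g x (c t) (deriv (deriv c) t) w
      + christoffelInChart g x (c t) (deriv c t) (deriv c t) w = 0

end Geodesic

/-! ### Homogeneous spaces

A homogeneous space `M = G/K` is a manifold `M` with a smooth transitive action of a Lie group `G`
and a base point `o`; then `K` is the stabilizer of `o`, and `π : G → G/K = M` is `a ↦ a • o`. -/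

section Homogeneous

variable {E : Type*} [NormedAddCommGroup E] [NormedSpace ℝ E] [CompleteSpace E]
  {F : Type*} [NormedAddCommGroup F] [NormedSpace ℝ F]
  {G : Type*} [TopologicalSpace G] [ChartedSpace E G] [Group G] [LieGroup 𝓘(ℝ, E) ∞ G]
  {M : Type*} [TopologicalSpace M] [ChartedSpace F M] [IsManifold 𝓘(ℝ, F) ∞ M] [MulAction G M]

/-- The differential at `1` of the projection `π : G → G/K = M`, `a ↦ a • o`. -/
def projDeriv (E F G : Type*) [NormedAddCommGroup E] [NormedSpace ℝ E]
    [NormedAddCommGroup F] [NormedSpace ℝ F]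
    [TopologicalSpace G] [ChartedSpace E G] [Group G]
    {M : Type*} [TopologicalSpace M] [ChartedSpace F M] [MulAction G M] (o : M) :
    GroupLieAlgebra 𝓘(ℝ, E) G →L[ℝ] TangentSpace 𝓘(ℝ, F) o :=
  (mfderiv 𝓘(ℝ, E) 𝓘(ℝ, F) (fun a : G => a • o) 1 : E →L[ℝ] F)

/-- The metric `g` is `G`-invariant: every translation `τ_a : p ↦ a • p` is an isometry. -/
def IsInvariantMetric (G : Type*) [Group G] [MulAction G M] (g : SmoothMetric F M) : Prop :=
  ∀ (a : G) (p : M) (u v : TangentSpace 𝓘(ℝ, F) p),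
    g.inner (a • p) (mfderiv 𝓘(ℝ, F) 𝓘(ℝ, F) (fun q : M => a • q) p u)
      (mfderiv 𝓘(ℝ, F) 𝓘(ℝ, F) (fun q : M => a • q) p v) = g.inner p u v

/-- `(M, g)` is a geodesic orbit space of `G`: every geodesic is an orbit of a one-parameter
subgroup of `G`. -/
def IsGeodesicOrbitSpace (E G : Type*) [NormedAddCommGroup E] [NormedSpace ℝ E]
    [TopologicalSpace G] [ChartedSpace E G] [Group G] [MulAction G M]
    (g : SmoothMetric F M) : Prop :=
  ∀ (γ : ℝ → M) (J : Set ℝ), IsOpen J → IsPreconnected J → (0 : ℝ) ∈ J → IsGeodesicOn g γ J →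
    ∃ X : GroupLieAlgebra 𝓘(ℝ, E) G, ∀ t ∈ J, γ t = lieExp (t • X) • γ 0

variable (E F G) in
/-- The structure of a generalized Wallach space on the homogeneous space `M = G/K`, where `K` is
the stabilizer of `o`: a decomposition `𝔤 = 𝔨 ⊕ 𝔪₁ ⊕ 𝔪₂ ⊕ 𝔪₃`, orthogonal for the Killing form, with
`𝔪ᵢ` invariant and irreducible under `Ad(K)` and `[𝔪ᵢ, 𝔪ᵢ] ⊆ 𝔨`. Here `M` is compact, `G` is
semisimple and acts almost effectively. (The `𝔪ᵢ` are indexed by `Fin 3`.) -/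
structure GeneralizedWallachSpace (o : M) where
  /-- The action of `G` on `M` is smooth. -/
  smooth_action : ContMDiffSMul 𝓘(ℝ, E) 𝓘(ℝ, F) ∞ G M
  /-- The action of `G` on `M` is transitive. -/
  transitive : MulAction.IsPretransitive G M
  /-- The smooth structure of `M` is that of `G/K`: the projection is a submersion (at `1`, hence,
  by homogeneity, everywhere). -/
  submersive : Function.Surjective (projDeriv E F G o)
  compact : CompactSpace M
  semisimple : LieAlgebra.IsSemisimple ℝ (GroupLieAlgebra 𝓘(ℝ, E) G)
  /-- The action is almost effective: its kernel is discrete. -/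
  almost_effective : DiscreteTopology {a : G // ∀ p : M, a • p = p}
  /-- The Lie algebra `𝔨` of the isotropy group `K`. -/
  k : Submodule ℝ (GroupLieAlgebra 𝓘(ℝ, E) G)
  mem_k : ∀ X : GroupLieAlgebra 𝓘(ℝ, E) G,
    X ∈ k ↔ ∀ t : ℝ, lieExp (t • X) ∈ MulAction.stabilizer G o
  /-- The submodules `𝔪₁, 𝔪₂, 𝔪₃`. -/
  m : Fin 3 → Submodule ℝ (GroupLieAlgebra 𝓘(ℝ, E) G)
  isInternal : DirectSum.IsInternal ![k, m 0, m 1, m 2]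
  orthogonal_k : ∀ i, ∀ x ∈ k, ∀ y ∈ m i, killingForm ℝ (GroupLieAlgebra 𝓘(ℝ, E) G) x y = 0
  orthogonal : ∀ i j, i ≠ j → ∀ x ∈ m i, ∀ y ∈ m j,
    killingForm ℝ (GroupLieAlgebra 𝓘(ℝ, E) G) x y = 0
  invariant : ∀ i, ∀ a ∈ MulAction.stabilizer G o, ∀ x ∈ m i, adjointRep a x ∈ m i
  nontrivial : ∀ i, m i ≠ ⊥
  irreducible : ∀ i, ∀ V : Submodule ℝ (GroupLieAlgebra 𝓘(ℝ, E) G), V ≤ m i →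
    (∀ a ∈ MulAction.stabilizer G o, ∀ x ∈ V, adjointRep a x ∈ V) → V = ⊥ ∨ V = m i
  bracket_mem : ∀ i, ∀ x ∈ m i, ∀ y ∈ m i, ⁅x, y⁆ ∈ k

/-- The metric `g` is the `G`-invariant diagonal metric `(l 0, l 1, l 2)`: at `o`, under the
identification `𝔪 ≅ T_o M` by `dπ`, it is `∑ i, l i * (-B)|_{𝔪 i}`, with `B` the Killing form. -/
structure GeneralizedWallachSpace.IsDiagonalMetric {o : M} (W : GeneralizedWallachSpace E F G o)
    (g : SmoothMetric F M) (l : Fin 3 → ℝ) : Prop where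
  invariant : IsInvariantMetric G g
  inner_eq : ∀ x y : Fin 3 → GroupLieAlgebra 𝓘(ℝ, E) G, (∀ i, x i ∈ W.m i) → (∀ i, y i ∈ W.m i) →
    g.inner o (projDeriv E F G o (∑ i, x i)) (projDeriv E F G o (∑ i, y i))
      = ∑ i, l i * (-(killingForm ℝ (GroupLieAlgebra 𝓘(ℝ, E) G) (x i) (y i)))

end Homogeneous

end

/-! Let X* denote the vector field on M generated by X ∈ 𝔤; it is a Killing field since g is
invariant. For any Killing field V one has ∇_V V = -½ grad |V|², so an orbit of its flow is a
geodesic wherever |V|² is critical. The flow preserves both V and g, so criticality at one point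
spreads along the whole orbit. Since X* at a·p is the translate by a of (Ad(a⁻¹)X)* at p,
differentiating |X*|² along Y* gives 2 g([X,Y]*, X*) (`mfderiv_fundamentalNormSq_projDeriv`). It
therefore suffices that g([X,Y]*, X*) = 0 at o for X, Y ∈ 𝔪.

This is algebra. By ad-invariance the trilinear form B([x,y],z) is alternating. On 𝔪ᵢ × 𝔪ⱼ × 𝔪ₖ it
vanishes when two indices agree, because [𝔪ᵢ,𝔪ᵢ] ⊂ 𝔨 ⊥ 𝔪. When the indices are distinct it vanishes
because one of the pairs commutes (`killingForm_bracket_eq_zero`). Hence each 𝔪ᵢ-component of [X,Y]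
is B-orthogonal to that of X, and a diagonal metric sees only these pairings, each multiplied by its
own coefficient.

Conversely, every initial velocity at o is X* for some X ∈ 𝔪, because 𝔨 projects to zero; at a·o the
generators are Ad(a)X. Geodesics are determined by initial position and velocity
(`IsGeodesicOn.eqOn`), so each one is such an orbit. The geometric steps are reduced to calculus in
charts: the geodesic equation of an isometric flow, completeness of left invariant fields, and the
bracket as the derivative of Ad. -/

open scoped Topology

noncomputable section

/-! ### Calculus in a vector space: isometric flows and second order equations -/

section Flat

variable {F : Type*} [NormedAddCommGroup F] [NormedSpace ℝ F]

/-- In flat coordinates: an orbit of a local flow of isometries of a metric `B` satisfies the geodesic equation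
at a point where the norm of the generating vector field is critical. -/
theorem geodesic_equation_of_isometric_flow {B : F → F →L[ℝ] F →L[ℝ] ℝ} {y₀ : F}
    (hB : DifferentiableAt ℝ B y₀) (hsymm : ∀ u v, B y₀ u v = B y₀ v u)
    {Φ : ℝ × F → F} (hΦ : ContDiffAt ℝ 2 Φ (0, y₀)) (hΦ₀ : Φ (0, y₀) = y₀)
    (hinv : ∀ u v, ∀ᶠ t in 𝓝 (0 : ℝ), B (Φ (t, y₀)) (fderiv ℝ Φ (t, y₀) (0, u))
      (fderiv ℝ Φ (t, y₀) (0, v)) = B y₀ u v)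
    (hid : ∀ u, fderiv ℝ Φ (0, y₀) (0, u) = u)
    (hcrit : ∀ w, fderiv ℝ (fun y => B y (fderiv ℝ Φ (0, y) (1, 0)) (fderiv ℝ Φ (0, y) (1, 0))) y₀ w
      = 0)
    {c : ℝ → F} {t₀ : ℝ} (hc₀ : c t₀ = y₀)
    (hc : ∀ᶠ t in 𝓝 t₀, HasDerivAt c (fderiv ℝ Φ (0, c t) (1, 0)) t) (w : F) :
    B (c t₀) (deriv (deriv c) t₀) w
      + (1 / 2 : ℝ) * (fderiv ℝ (fun z => B z (deriv c t₀) w) (c t₀) (deriv c t₀)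
        + fderiv ℝ (fun z => B z (deriv c t₀) w) (c t₀) (deriv c t₀)
        - fderiv ℝ (fun z => B z (deriv c t₀) (deriv c t₀)) (c t₀) w) = 0 := by
  have hD : DifferentiableAt ℝ (fderiv ℝ Φ) (0, y₀) :=
    (hΦ.fderiv_right (m := 1) (by norm_num)).differentiableAt (by norm_num)
  set D2 := fderiv ℝ (fderiv ℝ Φ) (0, y₀) with hD2
  have hsnd : ∀ a b, D2 a b = D2 b a := fun a b =>
    (hΦ.isSymmSndFDerivAt (by simp)).eq a b
  set V : F → F := fun y => fderiv ℝ Φ (0, y) (1, 0) with hV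
  -- derivative of `V`
  have hVd : HasFDerivAt V ((D2.comp (ContinuousLinearMap.inr ℝ ℝ F)).flip (1, 0)) y₀ := by
    have h1 : HasFDerivAt (fun y : F => fderiv ℝ Φ ((0 : ℝ), y))
        (D2.comp (ContinuousLinearMap.inr ℝ ℝ F)) y₀ :=
      HasFDerivAt.comp (f := fun y : F => ((0 : ℝ), y)) y₀ hD.hasFDerivAt
        (hasFDerivAt_prodMk_right 0 y₀)
    have := h1.clm_apply (hasFDerivAt_const ((1 : ℝ), (0 : F)) y₀)
    convert this using 1
    ext; simp
  set A := (D2.comp (ContinuousLinearMap.inr ℝ ℝ F)).flip (1, 0) with hA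
  have hAapp : ∀ u, A u = D2 (0, u) (1, 0) := fun u => by simp [hA]
  have hpath : HasDerivAt (fun t : ℝ => (t, y₀)) ((1 : ℝ), (0 : F)) 0 :=
    (hasDerivAt_id (0 : ℝ)).prodMk (hasDerivAt_const _ _)
  -- By symmetry of second derivatives, the same `A` is the time derivative of the spatial
  -- differential.
  have hDt : ∀ u, HasDerivAt (fun t : ℝ => fderiv ℝ Φ (t, y₀) (0, u)) (A u) 0 := by
    intro u
    have h1 : HasDerivAt (fun t : ℝ => fderiv ℝ Φ (t, y₀)) (D2 (1, 0)) 0 :=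
      HasFDerivAt.comp_hasDerivAt (f := fun t : ℝ => (t, y₀)) 0
        hD.hasFDerivAt hpath
    have := h1.clm_apply (hasDerivAt_const (0 : ℝ) ((0 : ℝ), u))
    convert this using 1
    simp [hAapp, hsnd (1, 0) (0, u)]
  have hΦt : HasDerivAt (fun t : ℝ => Φ (t, y₀)) (V y₀) 0 :=
    HasFDerivAt.comp_hasDerivAt (f := fun t : ℝ => (t, y₀)) 0
      (hΦ.differentiableAt (by norm_num)).hasFDerivAt hpath
  have hBt : HasDerivAt (fun t : ℝ => B (Φ (t, y₀))) (fderiv ℝ B y₀ (V y₀)) 0 := by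
    have h1 : HasFDerivAt B (fderiv ℝ B y₀) (Φ (0, y₀)) := by rw [hΦ₀]; exact hB.hasFDerivAt
    have h2 := (HasFDerivAt.comp (g := B) (f := fun t : ℝ => Φ (t, y₀)) (0 : ℝ) h1
      hΦt.hasFDerivAt).hasDerivAt
    simpa [Function.comp_def] using h2
  set B' := fderiv ℝ B y₀ with hB'
  -- The Killing equation: the derivative at t = 0 of the invariance of the metric.
  have killing : ∀ u v, B' (V y₀) u v + B y₀ (A u) v + B y₀ u (A v) = 0 := by
    intro u v
    have h1 := (hBt.clm_apply (hDt u)).clm_apply (hDt v)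
    have h2 : HasDerivAt (fun t : ℝ => B (Φ (t, y₀)) (fderiv ℝ Φ (t, y₀) (0, u))
      (fderiv ℝ Φ (t, y₀) (0, v))) 0 0 :=
      (hasDerivAt_const (0 : ℝ) (B y₀ u v)).congr_of_eventuallyEq (hinv u v)
    have h3 := h1.unique h2
    simpa [hΦ₀, hid] using h3
  have hf : ∀ w, B' w (V y₀) (V y₀) + B y₀ (A w) (V y₀) + B y₀ (V y₀) (A w) = 0 := by
    intro w
    have h1 := (hB.hasFDerivAt.clm_apply hVd).clm_apply hVd
    have h2 := h1.fderiv ▸ hcrit w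
    simp at h2
    linarith
  have hc1 : deriv c t₀ = V y₀ := by rw [hc.self_of_nhds.deriv, hc₀]
  have hc2 : deriv (deriv c) t₀ = A (V y₀) := by
    have h1 : deriv c =ᶠ[𝓝 t₀] fun t => V (c t) := by
      filter_upwards [hc] with t ht using ht.deriv
    rw [h1.deriv_eq]
    have h2 : HasDerivAt c (V y₀) t₀ := by simpa [hc₀] using hc.self_of_nhds
    have h3 : HasFDerivAt V A (c t₀) := by rw [hc₀]; exact hVd
    exact (h3.comp_hasDerivAt t₀ h2).deriv
  have hBu : ∀ u v w, fderiv ℝ (fun z => B z u v) y₀ w = B' w u v := by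
    intro u v w
    have h1 := (hB.hasFDerivAt.clm_apply (hasFDerivAt_const u y₀)).clm_apply
      (hasFDerivAt_const v y₀)
    rw [h1.fderiv]; simp [hB']
  -- With c' = V and c'' = A V, the Killing equation at (V, w) leaves -B(V, A w) - ½ B'(w)(V, V),
  -- which is zero by criticality.
  rw [hc1, hc2, hc₀, hBu, hBu]
  have k := killing (V y₀) w
  have f := hf w
  have s := hsymm (A w) (V y₀)
  linarith

theorem ContDiffAt.deriv_right {n m : WithTop ℕ∞} {c : ℝ → F} {t : ℝ} (hc : ContDiffAt ℝ n c t)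
    (h : m + 1 ≤ n) : ContDiffAt ℝ m (deriv c) t := by
  have := (hc.fderiv_right h).clm_apply (contDiffAt_const (c := (1 : ℝ)))
  exact this

/-- Local uniqueness for second order differential equations. -/
theorem eventuallyEq_of_second_order_ode {S : F × F → F} {c₁ c₂ : ℝ → F} {t₀ : ℝ}
    (hS : ContDiffAt ℝ 1 S (c₁ t₀, deriv c₁ t₀))
    (h₁ : ContDiffAt ℝ 2 c₁ t₀) (h₂ : ContDiffAt ℝ 2 c₂ t₀)
    (e₁ : ∀ᶠ t in 𝓝 t₀, deriv (deriv c₁) t = S (c₁ t, deriv c₁ t))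
    (e₂ : ∀ᶠ t in 𝓝 t₀, deriv (deriv c₂) t = S (c₂ t, deriv c₂ t))
    (h0 : c₁ t₀ = c₂ t₀) (h0' : deriv c₁ t₀ = deriv c₂ t₀) : c₁ =ᶠ[𝓝 t₀] c₂ := by
  -- Lipschitz uniqueness is applied to the first order system for the pair (c, c').
  obtain ⟨K, s, hs, hK⟩ : ∃ K, ∃ s ∈ 𝓝 (c₁ t₀, deriv c₁ t₀),
      LipschitzOnWith K (fun p : F × F => (p.2, S p)) s :=
    (contDiffAt_snd.prodMk hS).exists_lipschitzOnWith
  have key : ∀ {c : ℝ → F}, ContDiffAt ℝ 2 c t₀ → (c t₀, deriv c t₀) = (c₁ t₀, deriv c₁ t₀) →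
      (∀ᶠ t in 𝓝 t₀, deriv (deriv c) t = S (c t, deriv c t)) →
      ∀ᶠ t in 𝓝 t₀, HasDerivAt (fun t => (c t, deriv c t)) (deriv c t, S (c t, deriv c t)) t ∧
        (c t, deriv c t) ∈ s := by
    intro c hc h0 e
    have hd : ContDiffAt ℝ 1 (deriv c) t₀ := hc.deriv_right (by norm_num)
    have a1 : ∀ᶠ t in 𝓝 t₀, ContDiffAt ℝ 2 c t := hc.eventually (by simp)
    have a2 : ∀ᶠ t in 𝓝 t₀, ContDiffAt ℝ 1 (deriv c) t := hd.eventually (by simp)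
    have a3 : ∀ᶠ t in 𝓝 t₀, (c t, deriv c t) ∈ s := by
      apply (hc.continuousAt.prodMk hd.continuousAt).eventually_mem
      rw [h0]; exact hs
    filter_upwards [a1, a2, a3, e] with t b1 b2 b3 b4
    refine ⟨?_, b3⟩
    have := (b1.differentiableAt (by norm_num)).hasDerivAt.prodMk
      (b2.differentiableAt (by norm_num)).hasDerivAt
    rwa [b4] at this
  have := ODE_solution_unique_of_eventually (v := fun _ p => (p.2, S p)) (s := fun _ => s)
    (K := K) (t₀ := t₀) (f := fun t => (c₁ t, deriv c₁ t)) (g := fun t => (c₂ t, deriv c₂ t))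
    (Filter.Eventually.of_forall fun _ => hK) (key h₁ rfl e₁) (key h₂ (by rw [h0, h0']) e₂)
    (by simp [h0, h0'])
  filter_upwards [this] with t ht
  exact congrArg Prod.fst ht

end Flat

/-! ### The metric in a chart -/

section Metric

variable {F : Type*} [NormedAddCommGroup F] [NormedSpace ℝ F]
  {M : Type*} [TopologicalSpace M] [ChartedSpace F M] [IsManifold 𝓘(ℝ, F) ∞ M]

/-- The vectors are taken along a map `b`, so that the lemma serves both for coordinate fields along
an inverse chart and for vector fields on M. -/
theorem SmoothMetric.contMDiffAt_inner {EN : Type*} [NormedAddCommGroup EN] [NormedSpace ℝ EN]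
    {HN : Type*} [TopologicalSpace HN] {IN : ModelWithCorners ℝ EN HN}
    {N : Type*} [TopologicalSpace N] [ChartedSpace HN N] (g : SmoothMetric F M)
    {b : N → M} {v w : ∀ n, TangentSpace 𝓘(ℝ, F) (b n)} {x : N}
    (hv : ContMDiffAt IN (𝓘(ℝ, F).prod 𝓘(ℝ, F)) ∞ (fun n => (⟨b n, v n⟩ : TangentBundle 𝓘(ℝ, F) M)) x)
    (hw : ContMDiffAt IN (𝓘(ℝ, F).prod 𝓘(ℝ, F)) ∞ (fun n => (⟨b n, w n⟩ : TangentBundle 𝓘(ℝ, F) M)) x) :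
    ContMDiffAt IN 𝓘(ℝ, ℝ) ∞ (fun n => g.inner (b n) (v n) (w n)) x := by
  have hb : ContMDiffAt IN 𝓘(ℝ, F) ∞ b x := by
    rw [Bundle.contMDiffAt_totalSpace] at hv
    exact hv.1
  have h : ContMDiffAt IN (𝓘(ℝ, F).prod 𝓘(ℝ, ℝ)) ∞ (fun n => Bundle.TotalSpace.mk' ℝ
      (E := Bundle.Trivial M ℝ) (b n) (g.inner (b n) (v n) (w n))) x := by
    apply ContMDiffAt.clm_bundle_apply₂ (F₁ := F) (F₂ := F)
    · exact ContMDiffAt.comp x g.contMDiff.contMDiffAt hb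
    · exact hv
    · exact hw
  rw [Bundle.contMDiffAt_totalSpace] at h
  exact h.2

variable (g : SmoothMetric F M) (x : M)

/-- The metric in the preferred chart at `x`, as a bilinear form depending on the point. -/
def chartForm (y : F) : F →L[ℝ] F →L[ℝ] ℝ :=
  let B : F →L[ℝ] F →L[ℝ] ℝ := g.inner ((extChartAt 𝓘(ℝ, F) x).symm y)
  let A : F →L[ℝ] F := mfderiv 𝓘(ℝ, F) 𝓘(ℝ, F) (extChartAt 𝓘(ℝ, F) x).symm y
  B.bilinearComp A A

theorem chartForm_apply (y u v : F) : chartForm g x y u v = metricInChart g x y u v := rfl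

variable {x}

theorem mdifferentiableAt_extChartAt_symm {y : F} (hy : y ∈ (extChartAt 𝓘(ℝ, F) x).target) :
    MDifferentiableAt 𝓘(ℝ, F) 𝓘(ℝ, F) (extChartAt 𝓘(ℝ, F) x).symm y :=
  (mdifferentiableOn_extChartAt_symm (I := 𝓘(ℝ, F)) y hy).mdifferentiableAt
    ((isOpen_extChartAt_target x).mem_nhds hy)

/-- Coordinate fields are the tangent map of the inverse chart applied to constant vectors, hence
smooth. -/
theorem contDiffAt_metricInChart {y : F} (hy : y ∈ (extChartAt 𝓘(ℝ, F) x).target) (u v : F) :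
    ContDiffAt ℝ ∞ (fun z => metricInChart g x z u v) y := by
  have key : ∀ u : F, ContMDiffAt 𝓘(ℝ, F) (𝓘(ℝ, F).prod 𝓘(ℝ, F)) ∞ (fun z : F =>
      (⟨(extChartAt 𝓘(ℝ, F) x).symm z,
        mfderiv 𝓘(ℝ, F) 𝓘(ℝ, F) (extChartAt 𝓘(ℝ, F) x).symm z u⟩ : TangentBundle 𝓘(ℝ, F) M)) y := by
    intro u
    have h1 : ContMDiffOn 𝓘(ℝ, F) 𝓘(ℝ, F) ∞ (extChartAt 𝓘(ℝ, F) x).symm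
      (extChartAt 𝓘(ℝ, F) x).target := contMDiffOn_extChartAt_symm x
    have ho := isOpen_extChartAt_target (I := 𝓘(ℝ, F)) x
    have h2 := h1.contMDiffOn_tangentMapWithin (m := ∞) (by simp) ho.uniqueMDiffOn
    have h3 : ContMDiffAt 𝓘(ℝ, F) (𝓘(ℝ, F).prod 𝓘(ℝ, F)) ∞ (fun z : F =>
      (⟨z, u⟩ : TangentBundle 𝓘(ℝ, F) F)) y :=
      contMDiffAt_vectorSpace_iff_contDiffAt.2 contDiffAt_const
    have h4 := (h2.contMDiffAt (x := (⟨y, u⟩ : TangentBundle 𝓘(ℝ, F) F))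
      ((ho.preimage (FiberBundle.continuous_proj F _)).mem_nhds hy)).comp y h3
    refine h4.congr_of_eventuallyEq ?_
    filter_upwards [ho.mem_nhds hy] with z hz
    simp only [Function.comp_def, tangentMapWithin]
    rw [mfderivWithin_eq_mfderiv (ho.uniqueMDiffOn z hz) (mdifferentiableAt_extChartAt_symm hz)]
  exact (g.contMDiffAt_inner (key u) (key v)).contDiffAt

theorem contDiffAt_chartForm [FiniteDimensional ℝ F] {y : F}
    (hy : y ∈ (extChartAt 𝓘(ℝ, F) x).target) : ContDiffAt ℝ ∞ (chartForm g x) y := by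
  have ho := isOpen_extChartAt_target (I := 𝓘(ℝ, F)) x
  refine ContDiffOn.contDiffAt (s := (extChartAt 𝓘(ℝ, F) x).target) ?_ (ho.mem_nhds hy)
  rw [contDiffOn_clm_apply]
  intro u
  rw [contDiffOn_clm_apply]
  intro v z hz
  exact (contDiffAt_metricInChart g hz u v).contDiffWithinAt

theorem chartForm_symm (y u v : F) : chartForm g x y u v = chartForm g x y v u :=
  g.symm ((extChartAt 𝓘(ℝ, F) x).symm y)
    (mfderiv 𝓘(ℝ, F) 𝓘(ℝ, F) (extChartAt 𝓘(ℝ, F) x).symm y u)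
    (mfderiv 𝓘(ℝ, F) 𝓘(ℝ, F) (extChartAt 𝓘(ℝ, F) x).symm y v)

theorem mfderiv_extChartAt_symm_injective {y : F} (hy : y ∈ (extChartAt 𝓘(ℝ, F) x).target) :
    Function.Injective (mfderiv 𝓘(ℝ, F) 𝓘(ℝ, F) (extChartAt 𝓘(ℝ, F) x).symm y) := by
  have h := mfderiv_extChartAt_comp_mfderivWithin_extChartAt_symm (I := 𝓘(ℝ, F)) hy
  rw [modelWithCornersSelf_coe, Set.range_id, mfderivWithin_univ] at h
  intro u v huv
  set A : F →L[ℝ] F := mfderiv 𝓘(ℝ, F) 𝓘(ℝ, F) (extChartAt 𝓘(ℝ, F) x).symm y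
  set C : F →L[ℝ] F := mfderiv 𝓘(ℝ, F) 𝓘(ℝ, F) (extChartAt 𝓘(ℝ, F) x)
    ((extChartAt 𝓘(ℝ, F) x).symm y)
  have h' : ∀ u : F, C (A u) = u := fun u => DFunLike.congr_fun h u
  exact (h' u).symm.trans ((congrArg C huv).trans (h' v))

theorem chartForm_injective {y : F} (hy : y ∈ (extChartAt 𝓘(ℝ, F) x).target) :
    Function.Injective (chartForm g x y) := by
  rw [injective_iff_map_eq_zero]
  intro u hu
  by_contra hne
  have h1 : chartForm g x y u u = 0 := by rw [hu]; rfl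
  refine (g.pos ((extChartAt 𝓘(ℝ, F) x).symm y)
    (mfderiv 𝓘(ℝ, F) 𝓘(ℝ, F) (extChartAt 𝓘(ℝ, F) x).symm y u) ?_).ne' h1
  intro h0
  apply hne
  apply mfderiv_extChartAt_symm_injective hy
  rw [h0]; exact (map_zero _).symm

/-- Positive definiteness gives injectivity into the dual, and equality of finite dimensions gives
the rest. This allows the geodesic equation to be solved for the acceleration. -/
theorem chartForm_isInvertible [FiniteDimensional ℝ F] {y : F}
    (hy : y ∈ (extChartAt 𝓘(ℝ, F) x).target) : (chartForm g x y).IsInvertible := by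
  have hinj := chartForm_injective g hy
  have hfr : Module.finrank ℝ F = Module.finrank ℝ (F →L[ℝ] ℝ) := by
    rw [← (LinearMap.toContinuousLinearMap (𝕜 := ℝ) (E := F) (F' := ℝ)).finrank_eq]
    exact (Subspace.dual_finrank_eq (K := ℝ) (V := F)).symm
  let e := LinearEquiv.ofInjectiveOfFinrankEq (chartForm g x y : F →ₗ[ℝ] (F →L[ℝ] ℝ)) hinj hfr
  exact ⟨e.toContinuousLinearEquiv, by ext; rfl⟩

end Metric

/-! ### Geodesics as solutions of a second order equation, and their uniqueness -/

section Spray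

set_option maxSynthPendingDepth 3

variable {F : Type*} [NormedAddCommGroup F] [NormedSpace ℝ F]
  {M : Type*} [TopologicalSpace M] [ChartedSpace F M] [IsManifold 𝓘(ℝ, F) ∞ M]
  (g : SmoothMetric F M) {x : M}

theorem fderiv_metricInChart [FiniteDimensional ℝ F] {y : F}
    (hy : y ∈ (extChartAt 𝓘(ℝ, F) x).target) (u v w : F) :
    fderiv ℝ (fun z => metricInChart g x z v w) y u = fderiv ℝ (chartForm g x) y u v w := by
  have h := (contDiffAt_chartForm g hy).differentiableAt (by simp)
  have h1 := (h.hasFDerivAt.clm_apply (hasFDerivAt_const v y)).clm_apply (hasFDerivAt_const w y)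
  have h2 : (fun z => metricInChart g x z v w) = fun z => chartForm g x z v w := rfl
  rw [h2, h1.fderiv]
  simp

variable (x) in
/-- The covector `w ↦ Γ(v, v; w)` of Christoffel symbols of the first kind in a chart. -/
def christoffelForm (p : F × F) : F →L[ℝ] ℝ :=
  fderiv ℝ (chartForm g x) p.1 p.2 p.2
    - (1 / 2 : ℝ) • ((fderiv ℝ (chartForm g x) p.1).flip p.2).flip p.2

theorem christoffelForm_apply [FiniteDimensional ℝ F] {y : F}
    (hy : y ∈ (extChartAt 𝓘(ℝ, F) x).target) (v w : F) :
    christoffelForm g x (y, v) w = christoffelInChart g x y v v w := by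
  simp only [christoffelForm, christoffelInChart, fderiv_metricInChart g hy]
  simp
  ring

variable (x) in
/-- The acceleration of a geodesic in a chart, as a function of position and velocity. -/
def geodesicAcceleration (p : F × F) : F :=
  -(chartForm g x p.1).inverse (christoffelForm g x p)

theorem contDiffAt_geodesicAcceleration [FiniteDimensional ℝ F] {y : F}
    (hy : y ∈ (extChartAt 𝓘(ℝ, F) x).target) (v : F) :
    ContDiffAt ℝ 1 (geodesicAcceleration g x) (y, v) := by
  have := FiniteDimensional.complete ℝ F
  have hform : ContDiffAt ℝ ∞ (fun p : F × F => chartForm g x p.1) (y, v) :=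
    ContDiffAt.comp (y, v) (f := Prod.fst) (contDiffAt_chartForm g hy) contDiffAt_fst
  have hinv : ContDiffAt ℝ 1 (fun p : F × F => (chartForm g x p.1).inverse) (y, v) := by
    obtain ⟨e, he⟩ := chartForm_isInvertible g hy
    have h1 : ContDiffAt ℝ 1 ContinuousLinearMap.inverse (chartForm g x y) :=
      he ▸ contDiffAt_map_inverse e
    exact ContDiffAt.comp (y, v) (f := fun p : F × F => chartForm g x p.1) h1
      (hform.of_le ENat.LEInfty.out)
  have hch : ContDiffAt ℝ 1 (christoffelForm g x) (y, v) := by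
    have ho : IsOpen ((extChartAt 𝓘(ℝ, F) x).target ×ˢ (Set.univ : Set F)) :=
      (isOpen_extChartAt_target x).prod isOpen_univ
    refine ContDiffOn.contDiffAt (s := (extChartAt 𝓘(ℝ, F) x).target ×ˢ Set.univ) ?_
      (ho.mem_nhds ⟨hy, trivial⟩)
    rw [contDiffOn_clm_apply]
    rintro w ⟨z, u⟩ ⟨hz, -⟩
    refine ContDiffAt.contDiffWithinAt ?_
    have hD : ContDiffAt ℝ 1 (fun p : F × F => fderiv ℝ (chartForm g x) p.1) (z, u) :=
      ContDiffAt.comp (z, u) (f := Prod.fst)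
        ((contDiffAt_chartForm g hz).fderiv_right (m := 1) (by norm_num; exact ENat.LEInfty.out))
        contDiffAt_fst
    have h2 : ContDiffAt ℝ 1 (fun p : F × F => p.2) (z, u) := contDiffAt_snd
    have hw : ContDiffAt ℝ 1 (fun _ : F × F => w) (z, u) := contDiffAt_const
    have a := ((hD.clm_apply h2).clm_apply h2).clm_apply hw
    have b := ((hD.clm_apply hw).clm_apply h2).clm_apply h2
    have := a.sub (b.const_smul (1 / 2 : ℝ))
    refine this.congr_of_eventuallyEq (Filter.Eventually.of_forall fun p => ?_)
    simp [christoffelForm]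
  exact (hinv.clm_apply hch).neg

/-- Nondegeneracy turns the equation tested against all w into an explicit one. -/
theorem eq_geodesicAcceleration [FiniteDimensional ℝ F] {y v a : F}
    (hy : y ∈ (extChartAt 𝓘(ℝ, F) x).target)
    (h : ∀ w, metricInChart g x y a w + christoffelInChart g x y v v w = 0) :
    a = geodesicAcceleration g x (y, v) := by
  have h1 : chartForm g x y a = -christoffelForm g x (y, v) := by
    ext w
    have := h w
    rw [← chartForm_apply, ← christoffelForm_apply g hy] at this
    simpa using eq_neg_of_add_eq_zero_left this
  rw [geodesicAcceleration, ← map_neg, ← h1]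
  exact ((chartForm_isInvertible g hy).inverse_apply_eq.2 rfl).symm

variable {g}

omit [IsManifold 𝓘(ℝ, F) ∞ M] in
-- The differential at t is computed in the chart centred at γ t, so no transition map enters.
theorem mfderiv_curve_eq_deriv {γ : ℝ → M} {t : ℝ}
    (h : MDifferentiableAt 𝓘(ℝ, ℝ) 𝓘(ℝ, F) γ t) :
    (mfderiv 𝓘(ℝ, ℝ) 𝓘(ℝ, F) γ t (1 : ℝ) : F)
      = deriv (fun s => extChartAt 𝓘(ℝ, F) (γ t) (γ s)) t := by
  have h1 : (mfderiv 𝓘(ℝ, ℝ) 𝓘(ℝ, F) γ t : ℝ →L[ℝ] F)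
      = fderivWithin ℝ (fun s => extChartAt 𝓘(ℝ, F) (γ t) (γ s)) (Set.range (id : ℝ → ℝ)) t :=
    h.mfderiv
  rw [Set.range_id, fderivWithin_univ] at h1
  exact congrArg (fun L : ℝ →L[ℝ] F => L 1) h1

theorem contDiffAt_extChartAt_comp {γ : ℝ → M} {t : ℝ} (h : ContMDiffAt 𝓘(ℝ, ℝ) 𝓘(ℝ, F) ∞ γ t)
    (hx : γ t ∈ (chartAt F x).source) :
    ContDiffAt ℝ ∞ (fun s => extChartAt 𝓘(ℝ, F) x (γ s)) t :=
  ((contMDiffAt_extChartAt' hx).comp t h).contDiffAt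

variable [FiniteDimensional ℝ F]

theorem IsGeodesicOn.eventually_deriv_deriv {γ : ℝ → M} {J : Set ℝ} (hγ : IsGeodesicOn g γ J)
    {t : ℝ} (hJ : J ∈ 𝓝 t) (hx : γ t ∈ (chartAt F x).source) :
    ∀ᶠ s in 𝓝 t, deriv (deriv fun s => extChartAt 𝓘(ℝ, F) x (γ s)) s
      = geodesicAcceleration g x (extChartAt 𝓘(ℝ, F) x (γ s),
        deriv (fun s => extChartAt 𝓘(ℝ, F) x (γ s)) s) := by
  have hc := (hγ.smooth.contMDiffAt hJ).continuousAt
  filter_upwards [hJ, hc.eventually_mem ((chartAt F x).open_source.mem_nhds hx)] with s hs hsx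
  refine eq_geodesicAcceleration g ((extChartAt 𝓘(ℝ, F) x).map_source ?_) fun w =>
    hγ.equation x s hs hsx w
  rwa [extChartAt_source]

/-- In one chart both curves solve the same equation with C¹ right-hand side; injectivity of the
chart on its source brings the equality back to M. -/
theorem IsGeodesicOn.eventuallyEq {γ σ : ℝ → M} {J : Set ℝ} (hγ : IsGeodesicOn g γ J)
    (hσ : IsGeodesicOn g σ J) {t : ℝ} (hJ : J ∈ 𝓝 t) (h : γ t = σ t)
    (h' : deriv (fun s => extChartAt 𝓘(ℝ, F) (γ t) (γ s)) t
      = deriv (fun s => extChartAt 𝓘(ℝ, F) (γ t) (σ s)) t) : γ =ᶠ[𝓝 t] σ := by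
  have hx : γ t ∈ (chartAt F (γ t)).source := mem_chart_source F (γ t)
  have hx' : σ t ∈ (chartAt F (γ t)).source := h ▸ hx
  have cγ := hγ.smooth.contMDiffAt hJ
  have cσ := hσ.smooth.contMDiffAt hJ
  have key := eventuallyEq_of_second_order_ode
    (contDiffAt_geodesicAcceleration g ((extChartAt 𝓘(ℝ, F) (γ t)).map_source
      (by rwa [extChartAt_source])) _)
    ((contDiffAt_extChartAt_comp cγ hx).of_le ENat.LEInfty.out)
    ((contDiffAt_extChartAt_comp cσ hx').of_le ENat.LEInfty.out)
    (hγ.eventually_deriv_deriv hJ hx) (hσ.eventually_deriv_deriv hJ hx') (by rw [h]) h'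
  filter_upwards [key, cγ.continuousAt.eventually_mem ((chartAt F _).open_source.mem_nhds hx),
    cσ.continuousAt.eventually_mem ((chartAt F _).open_source.mem_nhds hx')] with s h1 h2 h3
  rw [← extChartAt_source 𝓘(ℝ, F)] at h2 h3
  exact (extChartAt 𝓘(ℝ, F) (γ t)).injOn h2 h3 h1

/-- Geodesics are determined by their position and velocity at one time. -/
theorem IsGeodesicOn.eqOn [T2Space M] {γ σ : ℝ → M} {J : Set ℝ} (hJ : IsOpen J)
    (hJ' : IsPreconnected J) (hγ : IsGeodesicOn g γ J) (hσ : IsGeodesicOn g σ J) {t₀ : ℝ}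
    (ht₀ : t₀ ∈ J) (h : γ t₀ = σ t₀)
    (h' : (mfderiv 𝓘(ℝ, ℝ) 𝓘(ℝ, F) γ t₀ (1 : ℝ) : F) = mfderiv 𝓘(ℝ, ℝ) 𝓘(ℝ, F) σ t₀ (1 : ℝ)) :
    Set.EqOn γ σ J := by
  -- The set of times near which the curves agree is open by construction; it remains to see that it
  -- is closed in J.
  set u : Set ℝ := {t | γ =ᶠ[𝓝 t] σ} with hu
  have hu_open : IsOpen u := isOpen_setOfPred_eventually_nhds
  have hsub : J ⊆ u := by
    refine hJ'.subset_of_closure_inter_subset hu_open ⟨t₀, ht₀, ?_⟩ ?_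
    · refine hγ.eventuallyEq hσ (hJ.mem_nhds ht₀) h ?_
      rw [mfderiv_curve_eq_deriv ((hγ.smooth.contMDiffAt (hJ.mem_nhds ht₀)).mdifferentiableAt
        (by simp)), mfderiv_curve_eq_deriv ((hσ.smooth.contMDiffAt
        (hJ.mem_nhds ht₀)).mdifferentiableAt (by simp)), ← h] at h'
      exact h'
    · rintro t ⟨htu, htJ⟩
      have cγ := hγ.smooth.contMDiffAt (hJ.mem_nhds htJ)
      have cσ := hσ.smooth.contMDiffAt (hJ.mem_nhds htJ)
      have : (𝓝[u] t).NeBot := mem_closure_iff_nhdsWithin_neBot.1 htu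
      have hle : 𝓝[u] t ≤ 𝓝 t := nhdsWithin_le_nhds
      -- At a limit time the positions agree by continuity and the Hausdorff property; the
      -- velocities, read in the fixed chart at γ t, agree by the same argument below.
      have heq : γ t = σ t := by
        refine tendsto_nhds_unique (cγ.continuousAt.tendsto.mono_left hle) ?_
        refine (cσ.continuousAt.tendsto.mono_left hle).congr' ?_
        filter_upwards [self_mem_nhdsWithin] with s hs
        exact (Filter.EventuallyEq.eq_of_nhds hs).symm
      refine hγ.eventuallyEq hσ (hJ.mem_nhds htJ) heq ?_
      have hx : γ t ∈ (chartAt F (γ t)).source := mem_chart_source F (γ t)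
      have d1 := (contDiffAt_extChartAt_comp cγ hx).deriv_right (m := 0) (by simp)
      have d2 := (contDiffAt_extChartAt_comp (x := γ t) cσ (heq ▸ hx)).deriv_right (m := 0) (by simp)
      refine tendsto_nhds_unique (d1.continuousAt.tendsto.mono_left hle) ?_
      refine (d2.continuousAt.tendsto.mono_left hle).congr' ?_
      filter_upwards [self_mem_nhdsWithin] with s hs
      refine Filter.EventuallyEq.deriv_eq ?_
      filter_upwards [show γ =ᶠ[𝓝 s] σ from hs] with r hr
      rw [hr]
  exact fun t ht => Filter.EventuallyEq.eq_of_nhds (hsub ht)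

end Spray

/-! ### Velocities, partial differentials and smoothness of integral curves -/

section Curves

set_option maxSynthPendingDepth 3

variable {E : Type*} [NormedAddCommGroup E] [NormedSpace ℝ E]
  {N : Type*} [TopologicalSpace N] [ChartedSpace E N]
  {E' : Type*} [NormedAddCommGroup E'] [NormedSpace ℝ E']
  {N' : Type*} [TopologicalSpace N'] [ChartedSpace E' N']
  {E'' : Type*} [NormedAddCommGroup E''] [NormedSpace ℝ E'']
  {N'' : Type*} [TopologicalSpace N''] [ChartedSpace E'' N'']

theorem HasDerivAt.hasFDerivAt_smulRight {f : ℝ → E} {f' : E} {t : ℝ} (h : HasDerivAt f f' t) :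
    HasFDerivAt f ((1 : ℝ →L[ℝ] ℝ).smulRight f') t := by
  have h1 : (1 : ℝ →L[ℝ] ℝ).smulRight f' = ContinuousLinearMap.toSpanSingleton ℝ f' := by
    ext
    simp
  rw [h1]
  exact h.hasFDerivAt

/-- Integral curves are specified by a differential of the form `smulRight`; this lemma and the next
translate to and from the value of the differential at 1. -/
theorem hasMFDerivAt_smulRight {γ : ℝ → N} {t : ℝ} {w : TangentSpace 𝓘(ℝ, E) (γ t)}
    (h : MDifferentiableAt 𝓘(ℝ, ℝ) 𝓘(ℝ, E) γ t)
    (hw : mfderiv 𝓘(ℝ, ℝ) 𝓘(ℝ, E) γ t (1 : ℝ) = w) :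
    HasMFDerivAt 𝓘(ℝ, ℝ) 𝓘(ℝ, E) γ t ((1 : ℝ →L[ℝ] ℝ).smulRight w) := by
  have h1 := h.hasMFDerivAt
  have h2 : (mfderiv 𝓘(ℝ, ℝ) 𝓘(ℝ, E) γ t : ℝ →L[ℝ] E)
      = ((1 : ℝ →L[ℝ] ℝ).smulRight (w : E) : ℝ →L[ℝ] E) := by
    exact ContinuousLinearMap.ext_ring (hw.trans (one_smul ℝ (w : E)).symm)
  exact h2 ▸ h1

theorem mfderiv_of_smulRight {γ : ℝ → N} {t : ℝ} {w : TangentSpace 𝓘(ℝ, E) (γ t)}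
    (h : HasMFDerivAt 𝓘(ℝ, ℝ) 𝓘(ℝ, E) γ t ((1 : ℝ →L[ℝ] ℝ).smulRight w)) :
    mfderiv 𝓘(ℝ, ℝ) 𝓘(ℝ, E) γ t (1 : ℝ) = w := by
  rw [h.mfderiv]
  exact one_smul ℝ (w : E)

/-- The partial derivative along a fixed tangent vector of the first factor is a smooth vector
field along the map. -/
theorem ContMDiff.partial_mfderiv [IsManifold 𝓘(ℝ, E) ∞ N] [IsManifold 𝓘(ℝ, E') ∞ N']
    [IsManifold 𝓘(ℝ, E'') ∞ N''] {f : N × N' → N''}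
    (hf : ContMDiff (𝓘(ℝ, E).prod 𝓘(ℝ, E')) 𝓘(ℝ, E'') ∞ f) (n : N) (u : TangentSpace 𝓘(ℝ, E) n) :
    ContMDiff 𝓘(ℝ, E') (𝓘(ℝ, E'').prod 𝓘(ℝ, E'')) ∞ (fun p : N' =>
      (⟨f (n, p), mfderiv 𝓘(ℝ, E) 𝓘(ℝ, E'') (fun m => f (m, p)) n u⟩ :
        TangentBundle 𝓘(ℝ, E'') N'')) := by
  -- The partial differential is the full tangent map on pairs (u, 0), so the second slot is fed by
  -- the zero section.
  have s1 : ContMDiff 𝓘(ℝ, E') (𝓘(ℝ, E').prod 𝓘(ℝ, E')) ∞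
      (fun p : N' => (⟨p, 0⟩ : TangentBundle 𝓘(ℝ, E') N')) := Bundle.contMDiff_zeroSection _ _
  have s2 : ContMDiff 𝓘(ℝ, E') (𝓘(ℝ, E).prod 𝓘(ℝ, E)) ∞
      (fun _ : N' => (⟨n, u⟩ : TangentBundle 𝓘(ℝ, E) N)) := contMDiff_const
  have s3 := s2.prodMk s1
  have s4 := (contMDiff_equivTangentBundleProd_symm (n := ∞) (I := 𝓘(ℝ, E)) (I' := 𝓘(ℝ, E'))
    (M := N) (M' := N')).comp s3
  have s5 := (hf.contMDiff_tangentMap (m := ∞) (by simp)).comp s4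
  convert s5 using 1
  funext p
  simp only [Function.comp_apply, tangentMap, equivTangentBundleProd]
  congr 1
  refine Eq.symm ((mfderiv_prod_eq_add_apply (hf.mdifferentiable (by simp) (n, p))).trans ?_)
  refine (congrArg₂ (· + ·) rfl (map_zero _)).trans (add_zero _)

/-- Integral curves of smooth vector fields are smooth. -/
theorem IsMIntegralCurve.contMDiff [IsManifold 𝓘(ℝ, E) ∞ N] {V : ∀ x : N, TangentSpace 𝓘(ℝ, E) x}
    (hV : ContMDiff 𝓘(ℝ, E) (𝓘(ℝ, E).prod 𝓘(ℝ, E)) ∞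
      (fun x => (⟨x, V x⟩ : TangentBundle 𝓘(ℝ, E) N)))
    {γ : ℝ → N} (hγ : IsMIntegralCurve γ V) : ContMDiff 𝓘(ℝ, ℝ) 𝓘(ℝ, E) ∞ γ := by
  intro t₀
  set φ : N → E := fun q => tangentCoordChange 𝓘(ℝ, E) q (γ t₀) q (V q)
  set v' : E → E := fun y => φ ((extChartAt 𝓘(ℝ, E) (γ t₀)).symm y)
  have hv : ContDiffAt ℝ ∞ v' (extChartAt 𝓘(ℝ, E) (γ t₀) (γ t₀)) :=
    ((contMDiffAt_iff.1 (hV (γ t₀))).2.contDiffAt (by simp)).snd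
  set c : ℝ → E := fun s => extChartAt 𝓘(ℝ, E) (γ t₀) (γ s) with hc
  have hd : ∀ᶠ s in 𝓝 t₀, HasDerivAt c (v' (c s)) s := by
    have hcont := (hγ.isMIntegralCurveAt t₀).continuousAt
    filter_upwards [(hγ.isMIntegralCurveAt t₀).eventually_hasDerivAt,
      hcont.eventually_mem (extChartAt_source_mem_nhds (I := 𝓘(ℝ, E)) (γ t₀))] with s hs hs'
    have h1 : v' (c s) = φ (γ s) := congrArg φ (PartialEquiv.left_inv _ hs')
    rw [h1]
    exact hs
  -- Bootstrapping: if c is Cⁿ then so is c' = v' ∘ c, hence c is Cⁿ⁺¹.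
  have key : ∀ n : ℕ, ContDiffAt ℝ n c t₀ := by
    intro n
    induction n with
    | zero =>
      exact contDiffAt_zero.2 (by
        obtain ⟨u, hu, hu'⟩ := Filter.eventually_iff_exists_mem.1 hd
        exact ⟨u, hu, fun s hs => (hu' s hs).continuousAt.continuousWithinAt⟩)
    | succ n ih =>
      push_cast
      rw [contDiffAt_succ_iff_hasFDerivAt]
      refine ⟨fun s => (1 : ℝ →L[ℝ] ℝ).smulRight (v' (c s)), ?_, ?_⟩
      · obtain ⟨u, hu, hu'⟩ := Filter.eventually_iff_exists_mem.1 hd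
        refine ⟨u, hu, fun s hs => ?_⟩
        exact (hu' s hs).hasFDerivAt_smulRight
      · have h1 : ContDiffAt ℝ n (fun s => v' (c s)) t₀ :=
          ContDiffAt.comp (g := v') (f := c) t₀ (hv.of_le ENat.LEInfty.out) ih
        exact contDiffAt_const.smulRight h1
  rw [contMDiffAt_iff_target]
  exact ⟨(hγ.isMIntegralCurveAt t₀).continuousAt, (contDiffAt_infty.2 key).contMDiffAt⟩

end Curves

/-! ### One-parameter subgroups and the exponential map -/

section Exponential

set_option maxSynthPendingDepth 3

variable {E : Type*} [NormedAddCommGroup E] [NormedSpace ℝ E]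
  {G : Type*} [TopologicalSpace G] [ChartedSpace E G] [Group G] [LieGroup 𝓘(ℝ, E) ∞ G]

instance : IsManifold 𝓘(ℝ, E) ∞ G := ContMDiffMul.toIsManifold

theorem mdifferentiable_mul_left' (a : G) :
    MDifferentiable 𝓘(ℝ, E) 𝓘(ℝ, E) (fun b : G => a * b) :=
  (contMDiff_mul_left (I := 𝓘(ℝ, E)) (n := ∞)).mdifferentiable (by simp)

theorem contMDiff_mulInvariantVectorField_infty (X : GroupLieAlgebra 𝓘(ℝ, E) G) :
    ContMDiff 𝓘(ℝ, E) (𝓘(ℝ, E).prod 𝓘(ℝ, E)) ∞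
      (fun a : G => (⟨a, mulInvariantVectorField X a⟩ : TangentBundle 𝓘(ℝ, E) G)) := by
  -- The factors are swapped because `partial_mfderiv` differentiates in the first one.
  have hf : ContMDiff (𝓘(ℝ, E).prod 𝓘(ℝ, E)) 𝓘(ℝ, E) ∞ (fun p : G × G => p.2 * p.1) :=
    contMDiff_snd.mul contMDiff_fst
  have h := hf.partial_mfderiv 1 X
  have e : ∀ (a b : G) (v : E), a = b →
      (⟨a, v⟩ : TangentBundle 𝓘(ℝ, E) G) = ⟨b, v⟩ := by rintro a _ v rfl; rfl
  exact h.congr fun a => e a (a * 1) _ (mul_one a).symm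

omit [LieGroup 𝓘(ℝ, E) ∞ G] in
theorem mulInvariantVectorField_one' (X : GroupLieAlgebra 𝓘(ℝ, E) G) :
    mulInvariantVectorField X (1 : G) = X := by
  have h : (fun b : G => 1 * b) = id := by funext b; simp
  unfold mulInvariantVectorField
  rw [h, mfderiv_id]
  rfl

/-- This is the chain rule for left translation by ab as the composite of those by b and a. -/
theorem mfderiv_mul_left_mulInvariantVectorField (X : GroupLieAlgebra 𝓘(ℝ, E) G) (a b : G) :
    mfderiv 𝓘(ℝ, E) 𝓘(ℝ, E) (fun c : G => a * c) b (mulInvariantVectorField X b)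
      = mulInvariantVectorField X (a * b) := by
  have h : (fun c : G => a * b * c) = (fun c => a * c) ∘ fun c => b * c := by
    funext c; simp [mul_assoc]
  have h1 := mfderiv_comp (I' := 𝓘(ℝ, E)) (1 : G) (mdifferentiable_mul_left' a (b * 1))
    (mdifferentiable_mul_left' b 1)
  rw [← h] at h1
  let D : G → E →L[ℝ] E := fun q => mfderiv 𝓘(ℝ, E) 𝓘(ℝ, E) (fun c : G => a * c) q
  let w : E := mulInvariantVectorField X b
  have h2 : (mulInvariantVectorField X (a * b) : E) = D (b * 1) w :=
    congrArg (fun L : E →L[ℝ] E => L X) h1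
  exact (congrArg (fun q => D q w) (mul_one b).symm).trans h2.symm

theorem IsMIntegralCurveOn.mul_left {X : GroupLieAlgebra 𝓘(ℝ, E) G} {γ : ℝ → G} {s : Set ℝ}
    (hs : IsOpen s) (h : IsMIntegralCurveOn (I := 𝓘(ℝ, E)) γ (mulInvariantVectorField X) s)
    (a : G) :
    IsMIntegralCurveOn (I := 𝓘(ℝ, E)) (fun t => a * γ t) (mulInvariantVectorField X) s := by
  intro t ht
  refine HasMFDerivAt.hasMFDerivWithinAt ?_
  have h1 := (h t ht).hasMFDerivAt (hs.mem_nhds ht)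
  have h2 := mdifferentiable_mul_left' (E := E) a (γ t)
  have h3 : MDifferentiableAt 𝓘(ℝ, ℝ) 𝓘(ℝ, E) (fun t => a * γ t) t :=
    h2.comp t h1.mdifferentiableAt
  refine hasMFDerivAt_smulRight h3 ?_
  refine (mfderiv_comp_apply t h2 h1.mdifferentiableAt (1 : ℝ)).trans ?_
  rw [mfderiv_of_smulRight h1]
  exact mfderiv_mul_left_mulInvariantVectorField X a (γ t)

theorem IsMIntegralCurve.mul_left {X : GroupLieAlgebra 𝓘(ℝ, E) G} {γ : ℝ → G}
    (h : IsMIntegralCurve (I := 𝓘(ℝ, E)) γ (mulInvariantVectorField X)) (a : G) :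
    IsMIntegralCurve (I := 𝓘(ℝ, E)) (fun t => a * γ t) (mulInvariantVectorField X) := by
  rw [isMIntegralCurve_iff_isMIntegralCurveOn] at h ⊢
  exact h.mul_left isOpen_univ a

omit [LieGroup 𝓘(ℝ, E) ∞ G] in
theorem IsOneParameterSubgroup.map_zero {X : GroupLieAlgebra 𝓘(ℝ, E) G} {α : ℝ → G}
    (h : IsOneParameterSubgroup X α) : α 0 = 1 := by
  have := h.map_add 0 0
  simpa using this

/-- Since α(s) = α(t) α(s - t), the velocity at t is the left translate of the velocity at 0. -/
theorem IsOneParameterSubgroup.isMIntegralCurve {X : GroupLieAlgebra 𝓘(ℝ, E) G} {α : ℝ → G}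
    (h : IsOneParameterSubgroup X α) :
    IsMIntegralCurve (I := 𝓘(ℝ, E)) α (mulInvariantVectorField X) := by
  intro t
  have hd : MDifferentiable 𝓘(ℝ, ℝ) 𝓘(ℝ, E) α := h.smooth.mdifferentiable (by simp)
  refine hasMFDerivAt_smulRight (hd t) ?_
  have h1 : HasMFDerivAt 𝓘(ℝ, ℝ) 𝓘(ℝ, E) α 0
      ((1 : ℝ →L[ℝ] ℝ).smulRight (mulInvariantVectorField X (α 0))) := by
    refine hasMFDerivAt_smulRight (hd 0) (h.velocity.trans ?_)
    refine (mulInvariantVectorField_one' X).symm.trans ?_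
    exact congrArg (fun a => (mulInvariantVectorField X a : E)) h.map_zero.symm
  have h2 : HasMFDerivAt 𝓘(ℝ, ℝ) 𝓘(ℝ, E) (fun s => α t * α s) 0
      ((1 : ℝ →L[ℝ] ℝ).smulRight (mulInvariantVectorField X (α t * α 0))) := by
    have h3 := mdifferentiable_mul_left' (E := E) (α t) (α 0)
    refine hasMFDerivAt_smulRight (h3.comp (0 : ℝ) (hd 0)) ?_
    refine (mfderiv_comp_apply (0 : ℝ) h3 (hd 0) (1 : ℝ)).trans ?_
    rw [mfderiv_of_smulRight h1]
    exact mfderiv_mul_left_mulInvariantVectorField X (α t) (α 0)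
  have h4 : (fun s => α t * α s) ∘ (fun s : ℝ => s - t) = α := by
    funext s
    simp [← h.map_add]
  have h5 : HasMFDerivAt 𝓘(ℝ, ℝ) 𝓘(ℝ, ℝ) (fun s : ℝ => s - t) t (ContinuousLinearMap.id ℝ ℝ) :=
    ((hasFDerivAt_id t).sub_const t).hasMFDerivAt
  have h6 := HasMFDerivAt.comp (I' := 𝓘(ℝ, ℝ)) t (g := fun s => α t * α s)
    (by rw [sub_self]; exact h2) h5
  rw [h4] at h6
  rw [h6.mfderiv]
  have h7 : α t * α 0 = α t := by rw [h.map_zero, mul_one]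
  refine Eq.trans (one_smul ℝ (mulInvariantVectorField X (α t * α 0) : E)) ?_
  exact congrArg (fun a => (mulInvariantVectorField X a : E)) h7

variable [T2Space G]

theorem IsOneParameterSubgroup.eq {X : GroupLieAlgebra 𝓘(ℝ, E) G} {α β : ℝ → G}
    (hα : IsOneParameterSubgroup X α) (hβ : IsOneParameterSubgroup X β) : α = β :=
  isMIntegralCurve_Ioo_eq_of_contMDiff_boundaryless (t₀ := 0) (I := 𝓘(ℝ, E))
    ((contMDiff_mulInvariantVectorField_infty X).of_le ENat.LEInfty.out)
    hα.isMIntegralCurve hβ.isMIntegralCurve (hα.map_zero.trans hβ.map_zero.symm)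

variable [CompleteSpace E]

/-- Left invariant vector fields are complete. -/
theorem exists_isOneParameterSubgroup (X : GroupLieAlgebra 𝓘(ℝ, E) G) :
    ∃ α : ℝ → G, IsOneParameterSubgroup X α := by
  have hV : ContMDiff 𝓘(ℝ, E) (𝓘(ℝ, E).prod 𝓘(ℝ, E)) 1
      (fun a : G => (⟨a, mulInvariantVectorField X a⟩ : TangentBundle 𝓘(ℝ, E) G)) :=
    (contMDiff_mulInvariantVectorField_infty X).of_le ENat.LEInfty.out
  obtain ⟨γ, hγ0, hγ⟩ := exists_isMIntegralCurveAt_of_contMDiffAt_boundaryless (I := 𝓘(ℝ, E))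
    (t₀ := 0) (x₀ := (1 : G)) hV.contMDiffAt
  obtain ⟨ε, hε, hγ⟩ := isMIntegralCurveAt_iff'.1 hγ
  rw [Real.ball_eq_Ioo, zero_sub, zero_add] at hγ
  -- Left translates of the local curve at 1 give integral curves through every point on the same
  -- interval (-ε, ε); a uniform existence time implies completeness.
  obtain ⟨α, hα0, hα⟩ := exists_isMIntegralCurve_of_isMIntegralCurveOn (I := 𝓘(ℝ, E)) hV hε
    (fun a => ⟨fun t => a * γ t, by simp [hγ0], hγ.mul_left isOpen_Ioo a⟩) (1 : G)
  refine ⟨α, hα.contMDiff (contMDiff_mulInvariantVectorField_infty X), fun s t => ?_, ?_⟩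
  -- The time shift and the left translate of α by α s are integral curves with the same start,
  -- hence equal.
  · have h1 := hα.comp_add s
    have h2 := hα.mul_left (α s)
    have h3 := isMIntegralCurve_Ioo_eq_of_contMDiff_boundaryless (t₀ := 0) (I := 𝓘(ℝ, E)) hV h1 h2
      (by simp [hα0])
    have h4 := congrFun h3 t
    simpa [add_comm] using h4
  · refine (mfderiv_of_smulRight (hα 0)).trans ?_
    refine (congrArg (fun a => (mulInvariantVectorField X a : E)) hα0).trans ?_
    exact mulInvariantVectorField_one' X

omit [T2Space G] [CompleteSpace E] [LieGroup 𝓘(ℝ, E) ∞ G] in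
theorem IsOneParameterSubgroup.comp_mul {X : GroupLieAlgebra 𝓘(ℝ, E) G} {α : ℝ → G}
    (h : IsOneParameterSubgroup X α) (t : ℝ) :
    IsOneParameterSubgroup (t • X) fun s => α (t * s) := by
  have hl : ContMDiff 𝓘(ℝ, ℝ) 𝓘(ℝ, ℝ) ∞ (fun s : ℝ => t * s) :=
    (contDiff_const.mul contDiff_id).contMDiff
  refine ⟨h.smooth.comp hl, fun r s => ?_, ?_⟩
  · rw [mul_add, h.map_add]
  · have hd : MDifferentiable 𝓘(ℝ, ℝ) 𝓘(ℝ, E) α := h.smooth.mdifferentiable (by simp)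
    have h5 : HasMFDerivAt 𝓘(ℝ, ℝ) 𝓘(ℝ, ℝ) (fun s : ℝ => t * s) 0
        ((1 : ℝ →L[ℝ] ℝ).smulRight t) := by
      have : HasDerivAt (fun s : ℝ => t * s) t 0 := by
        simpa using (hasDerivAt_id (0 : ℝ)).const_mul t
      exact this.hasFDerivAt_smulRight.hasMFDerivAt
    have h1 : HasMFDerivAt 𝓘(ℝ, ℝ) 𝓘(ℝ, E) α (t * 0) (mfderiv 𝓘(ℝ, ℝ) 𝓘(ℝ, E) α (t * 0)) :=
      (hd _).hasMFDerivAt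
    have h6 := HasMFDerivAt.comp (I' := 𝓘(ℝ, ℝ)) (0 : ℝ) h1 h5
    let D : ℝ → ℝ →L[ℝ] E := fun s => mfderiv 𝓘(ℝ, ℝ) 𝓘(ℝ, E) α s
    have h7 : (mfderiv 𝓘(ℝ, ℝ) 𝓘(ℝ, E) (fun s => α (t * s)) 0 (1 : ℝ) : E)
        = D (t * 0) ((1 : ℝ) * t) :=
      congrArg (fun L : ℝ →L[ℝ] E => L 1) h6.mfderiv
    refine h7.trans ?_
    rw [mul_zero, one_mul]
    have h8 : D 0 t = t • D 0 1 := by rw [← (D 0).map_smul, smul_eq_mul, mul_one]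
    exact h8.trans (congrArg (fun v : E => t • v) h.velocity)

omit [CompleteSpace E] in
-- Uniqueness makes the choice in `lieExp` immaterial.
theorem IsOneParameterSubgroup.lieExp_eq {X : GroupLieAlgebra 𝓘(ℝ, E) G} {α : ℝ → G}
    (h : IsOneParameterSubgroup X α) : lieExp X = α 1 := by
  have hex : ∃ α : ℝ → G, IsOneParameterSubgroup X α := ⟨α, h⟩
  rw [lieExp, dif_pos hex, hex.choose_spec.eq h]

theorem IsOneParameterSubgroup.lieExp_smul {X : GroupLieAlgebra 𝓘(ℝ, E) G} {α : ℝ → G}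
    (h : IsOneParameterSubgroup X α) (t : ℝ) : lieExp (t • X) = α t := by
  rw [(h.comp_mul t).lieExp_eq, mul_one]

theorem isOneParameterSubgroup_lieExp (X : GroupLieAlgebra 𝓘(ℝ, E) G) :
    IsOneParameterSubgroup X fun t => lieExp (t • X) := by
  obtain ⟨α, h⟩ := exists_isOneParameterSubgroup X
  convert h using 1
  funext t
  exact h.lieExp_smul t

end Exponential

/-! ### The chain rule in model spaces and the adjoint representation -/

section ChainRule

variable {E : Type*} [NormedAddCommGroup E] [NormedSpace ℝ E]
  {N : Type*} [TopologicalSpace N] [ChartedSpace E N]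
  {E' : Type*} [NormedAddCommGroup E'] [NormedSpace ℝ E']
  {N' : Type*} [TopologicalSpace N'] [ChartedSpace E' N']
  {E'' : Type*} [NormedAddCommGroup E''] [NormedSpace ℝ E'']
  {N'' : Type*} [TopologicalSpace N''] [ChartedSpace E'' N'']

/-- The chain rule in the model spaces, with a propositional equation for the middle point. -/
theorem mfderiv_comp_model {h : N' → N''} {f : N → N'} {x : N} {y : N'} (hy : f x = y)
    (hh : MDifferentiableAt 𝓘(ℝ, E') 𝓘(ℝ, E'') h y) (hf : MDifferentiableAt 𝓘(ℝ, E) 𝓘(ℝ, E') f x)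
    (v : E) :
    (mfderiv 𝓘(ℝ, E) 𝓘(ℝ, E'') (fun z => h (f z)) x : E →L[ℝ] E'') v
      = (mfderiv 𝓘(ℝ, E') 𝓘(ℝ, E'') h y : E' →L[ℝ] E'')
        ((mfderiv 𝓘(ℝ, E) 𝓘(ℝ, E') f x : E →L[ℝ] E') v) := by
  subst hy
  exact mfderiv_comp_apply x hh hf v

end ChainRule

section Adjoint

set_option maxSynthPendingDepth 3

variable {E : Type*} [NormedAddCommGroup E] [NormedSpace ℝ E]
  {G : Type*} [TopologicalSpace G] [ChartedSpace E G] [Group G] [LieGroup 𝓘(ℝ, E) ∞ G]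

theorem mdifferentiable_conj (a : G) :
    MDifferentiable 𝓘(ℝ, E) 𝓘(ℝ, E) (fun b : G => a * b * a⁻¹) := by
  have h : ContMDiff 𝓘(ℝ, E) 𝓘(ℝ, E) ∞ (fun b : G => a * b * a⁻¹) :=
    (contMDiff_const.mul contMDiff_id).mul contMDiff_const
  exact h.mdifferentiable (by simp)

theorem adjointRep_mul_apply (a b : G) (X : GroupLieAlgebra 𝓘(ℝ, E) G) :
    adjointRep (a * b) X = adjointRep a (adjointRep b X) := by
  have h := mfderiv_comp_model (E := E) (E' := E) (E'' := E) (x := (1 : G)) (y := (1 : G))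
    (h := fun c : G => a * c * a⁻¹) (f := fun c : G => b * c * b⁻¹) (by simp)
    (mdifferentiable_conj a 1) (mdifferentiable_conj b 1) X
  refine Eq.trans ?_ h
  have h1 : (fun c : G => a * b * c * (a * b)⁻¹) = fun c => a * (b * c * b⁻¹) * a⁻¹ := by
    funext c
    group
  unfold adjointRep
  rw [h1]
  rfl

omit [LieGroup 𝓘(ℝ, E) ∞ G] in
theorem adjointRep_one_apply (X : GroupLieAlgebra 𝓘(ℝ, E) G) : adjointRep (1 : G) X = X := by
  have h1 : (fun c : G => 1 * c * 1⁻¹) = id := by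
    funext c
    simp
  unfold adjointRep
  rw [h1]
  exact congrArg (fun L : E →L[ℝ] E => L X) (mfderiv_id (I := 𝓘(ℝ, E)) (x := (1 : G)))

theorem adjointRep_inv_apply_self (a : G) (X : GroupLieAlgebra 𝓘(ℝ, E) G) :
    adjointRep a⁻¹ (adjointRep a X) = X := by
  rw [← adjointRep_mul_apply, inv_mul_cancel, adjointRep_one_apply]

theorem IsOneParameterSubgroup.conj {X : GroupLieAlgebra 𝓘(ℝ, E) G} {α : ℝ → G}
    (h : IsOneParameterSubgroup X α) (a : G) :
    IsOneParameterSubgroup (adjointRep a X) fun t => a * α t * a⁻¹ := by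
  refine ⟨(contMDiff_const.mul h.smooth).mul contMDiff_const, fun s t => ?_, ?_⟩
  · rw [h.map_add]
    group
  · have h1 := mfderiv_comp_model (E := ℝ) (E' := E) (E'' := E) (x := (0 : ℝ)) (y := (1 : G))
      (h := fun c : G => a * c * a⁻¹) (f := α) h.map_zero
      (mdifferentiable_conj a 1) (h.smooth.mdifferentiable (by simp) 0) (1 : ℝ)
    refine h1.trans ?_
    exact congrArg (fun v : E => (adjointRep a : E →L[ℝ] E) v) h.velocity

omit [LieGroup 𝓘(ℝ, E) ∞ G] in
theorem IsOneParameterSubgroup.commute {X : GroupLieAlgebra 𝓘(ℝ, E) G} {α : ℝ → G}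
    (h : IsOneParameterSubgroup X α) (s t : ℝ) : α s * α t = α t * α s := by
  rw [← h.map_add, ← h.map_add, add_comm]

/-- The subgroup is commutative, so conjugation by (α t)⁻¹ fixes it pointwise; compare initial
velocities. -/
theorem IsOneParameterSubgroup.adjointRep_inv {X : GroupLieAlgebra 𝓘(ℝ, E) G} {α : ℝ → G}
    (h : IsOneParameterSubgroup X α) (t : ℝ) : adjointRep (α t)⁻¹ X = X := by
  have h1 := h.conj (α t)⁻¹
  have h2 : (fun s => (α t)⁻¹ * α s * (α t)⁻¹⁻¹) = α := by
    funext s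
    rw [inv_inv, mul_assoc, h.commute s t, inv_mul_cancel_left]
  rw [h2] at h1
  exact h1.velocity.symm.trans h.velocity

end Adjoint

/-! ### Fundamental vector fields of a smooth action and their norms -/

theorem mdifferentiable_translation (E : Type*) [NormedAddCommGroup E] [NormedSpace ℝ E]
    {F : Type*} [NormedAddCommGroup F] [NormedSpace ℝ F]
    {G : Type*} [TopologicalSpace G] [ChartedSpace E G] [Group G]
    {M : Type*} [TopologicalSpace M] [ChartedSpace F M] [MulAction G M]
    [ContMDiffSMul 𝓘(ℝ, E) 𝓘(ℝ, F) ∞ G M] (a : G) :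
    MDifferentiable 𝓘(ℝ, F) 𝓘(ℝ, F) (fun p : M => a • p) := by
  have h : ContMDiff 𝓘(ℝ, F) 𝓘(ℝ, F) ∞ (fun p : M => a • p) :=
    ContMDiffSMul.contMDiff_const_smul (I := 𝓘(ℝ, E)) a
  exact h.mdifferentiable (by simp)

section Action

set_option maxSynthPendingDepth 3

variable {E : Type*} [NormedAddCommGroup E] [NormedSpace ℝ E]
  {F : Type*} [NormedAddCommGroup F] [NormedSpace ℝ F]
  {G : Type*} [TopologicalSpace G] [ChartedSpace E G] [Group G] [LieGroup 𝓘(ℝ, E) ∞ G]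
  {M : Type*} [TopologicalSpace M] [ChartedSpace F M] [IsManifold 𝓘(ℝ, F) ∞ M] [MulAction G M]
  [ContMDiffSMul 𝓘(ℝ, E) 𝓘(ℝ, F) ∞ G M]

variable (E F G M) in
omit [LieGroup 𝓘(ℝ, E) ∞ G] [IsManifold 𝓘(ℝ, F) ∞ M] in
theorem contMDiff_action :
    ContMDiff (𝓘(ℝ, E).prod 𝓘(ℝ, F)) 𝓘(ℝ, F) ∞ (fun p : G × M => p.1 • p.2) :=
  contMDiff_smul

omit [LieGroup 𝓘(ℝ, E) ∞ G] [IsManifold 𝓘(ℝ, F) ∞ M] in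
theorem mdifferentiable_orbitMap (p : M) :
    MDifferentiable 𝓘(ℝ, E) 𝓘(ℝ, F) (fun a : G => a • p) := by
  have h : ContMDiff 𝓘(ℝ, E) 𝓘(ℝ, F) ∞ (fun a : G => a • p) :=
    (contMDiff_action E F G M).comp (contMDiff_id.prodMk contMDiff_const)
  exact h.mdifferentiable (by simp)

variable (F M) in
/-- The fundamental vector field of `X` is smooth. -/
theorem contMDiff_projDeriv (X : GroupLieAlgebra 𝓘(ℝ, E) G) :
    ContMDiff 𝓘(ℝ, F) (𝓘(ℝ, F).prod 𝓘(ℝ, F)) ∞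
      (fun p : M => (⟨p, projDeriv E F G p X⟩ : TangentBundle 𝓘(ℝ, F) M)) := by
  have h := (contMDiff_action E F G M).partial_mfderiv 1 X
  have e : ∀ (p q : M) (v : F), p = q →
      (⟨p, v⟩ : TangentBundle 𝓘(ℝ, F) M) = ⟨q, v⟩ := by rintro p _ v rfl; rfl
  exact h.congr fun p => e p ((1 : G) • p) _ (one_smul G p).symm

omit [IsManifold 𝓘(ℝ, F) ∞ M] in
-- Differentiate b·(a·p) = a·((a⁻¹ba)·p) at b = 1.
theorem projDeriv_smul (a : G) (p : M) (X : GroupLieAlgebra 𝓘(ℝ, E) G) :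
    (projDeriv E F G (a • p) X : F)
      = (mfderiv 𝓘(ℝ, F) 𝓘(ℝ, F) (fun q : M => a • q) p : F →L[ℝ] F)
        (projDeriv E F G p (adjointRep a⁻¹ X)) := by
  have h1 := mfderiv_comp_model (E := E) (E' := E) (E'' := F) (x := (1 : G)) (y := (1 : G))
    (h := fun b : G => b • p) (f := fun b : G => a⁻¹ * b * a⁻¹⁻¹) (by simp)
    (mdifferentiable_orbitMap p 1) (mdifferentiable_conj a⁻¹ 1) X
  have h2 := mfderiv_comp_model (E := E) (E' := F) (E'' := F) (x := (1 : G)) (y := p)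
    (h := fun q : M => a • q) (f := fun b : G => (a⁻¹ * b * a⁻¹⁻¹) • p) (by simp)
    (mdifferentiable_translation E a p)
    ((mdifferentiable_orbitMap p _).comp (1 : G) (mdifferentiable_conj a⁻¹ 1)) X
  have h3 : (fun b : G => b • a • p) = fun b : G => a • (a⁻¹ * b * a⁻¹⁻¹) • p := by
    funext b
    simp only [smul_smul]
    congr 1
    group
  have h4 : (projDeriv E F G (a • p) X : F) = (mfderiv 𝓘(ℝ, E) 𝓘(ℝ, F)
      (fun b : G => a • (a⁻¹ * b * a⁻¹⁻¹) • p) 1 : E →L[ℝ] F) X := by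
    rw [← h3]
    rfl
  refine h4.trans (h2.trans ?_)
  exact congrArg _ h1

omit [LieGroup 𝓘(ℝ, E) ∞ G] [IsManifold 𝓘(ℝ, F) ∞ M] in
theorem IsOneParameterSubgroup.mfderiv_smul_zero {X : GroupLieAlgebra 𝓘(ℝ, E) G} {α : ℝ → G}
    (h : IsOneParameterSubgroup X α) (p : M) :
    (mfderiv 𝓘(ℝ, ℝ) 𝓘(ℝ, F) (fun t => α t • p) 0 (1 : ℝ) : F) = projDeriv E F G p X := by
  have h1 := mfderiv_comp_model (E := ℝ) (E' := E) (E'' := F) (x := (0 : ℝ)) (y := (1 : G))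
    (h := fun b : G => b • p) (f := α) h.map_zero (mdifferentiable_orbitMap p 1)
    (h.smooth.mdifferentiable (by simp) 0) (1 : ℝ)
  refine h1.trans ?_
  exact congrArg (fun v : E => (projDeriv E F G p : E →L[ℝ] F) v) h.velocity

variable (g : SmoothMetric F M)

/-- The squared norm of the fundamental vector field of `X`. -/
def fundamentalNormSq (X : GroupLieAlgebra 𝓘(ℝ, E) G) (p : M) : ℝ :=
  g.inner p (projDeriv E F G p X) (projDeriv E F G p X)

theorem contMDiff_fundamentalNormSq (X : GroupLieAlgebra 𝓘(ℝ, E) G) :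
    ContMDiff 𝓘(ℝ, F) 𝓘(ℝ, ℝ) ∞ (fundamentalNormSq g X) := fun p =>
  g.contMDiffAt_inner (contMDiff_projDeriv F M X p) (contMDiff_projDeriv F M X p)

variable {g}

/-- Moving the point is traded for moving X by Ad, so that norms along an orbit are all computed in
one tangent space. -/
theorem fundamentalNormSq_smul (hg : IsInvariantMetric G g) (X : GroupLieAlgebra 𝓘(ℝ, E) G)
    (a : G) (p : M) :
    fundamentalNormSq g X (a • p) = fundamentalNormSq g (adjointRep a⁻¹ X) p := by
  let B : F →L[ℝ] F →L[ℝ] ℝ := g.inner (a • p)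
  have h : fundamentalNormSq g X (a • p) = B (projDeriv E F G (a • p) X : F)
    (projDeriv E F G (a • p) X : F) := rfl
  rw [h, projDeriv_smul]
  exact hg a p _ _

/-- The fundamental vector field of `X` has critical norm at `p`. -/
def IsCriticalAt (g : SmoothMetric F M) (X : GroupLieAlgebra 𝓘(ℝ, E) G) (p : M) : Prop :=
  ∀ v : F, (mfderiv 𝓘(ℝ, F) 𝓘(ℝ, ℝ) (fundamentalNormSq g X) p : F →L[ℝ] ℝ) v = 0

theorem IsCriticalAt.smul (hg : IsInvariantMetric G g) {X : GroupLieAlgebra 𝓘(ℝ, E) G} {a : G}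
    {p : M} (h : IsCriticalAt g (adjointRep a⁻¹ X) p) : IsCriticalAt g X (a • p) := by
  intro v
  have h1 : fundamentalNormSq g X
      = fun q => fundamentalNormSq g (adjointRep a⁻¹ X) (a⁻¹ • q) := by
    funext q
    rw [← fundamentalNormSq_smul hg, smul_inv_smul]
  have h2 := mfderiv_comp_model (E := F) (E' := F) (E'' := ℝ) (x := a • p) (y := p)
    (h := fundamentalNormSq g (adjointRep a⁻¹ X)) (f := fun q => a⁻¹ • q) (inv_smul_smul a p)
    ((contMDiff_fundamentalNormSq g _).mdifferentiable (by simp) p)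
    (mdifferentiable_translation E a⁻¹ _) v
  rw [h1]
  exact h2.trans (h _)

/-- Ad(α t)⁻¹ fixes X, so criticality at p spreads along the orbit and the geodesic equation can be
checked at every time. -/
theorem IsCriticalAt.smul_of_isOneParameterSubgroup (hg : IsInvariantMetric G g)
    {X : GroupLieAlgebra 𝓘(ℝ, E) G} {α : ℝ → G} (hα : IsOneParameterSubgroup X α) {p : M}
    (h : IsCriticalAt g X p) (t : ℝ) : IsCriticalAt g X (α t • p) := by
  refine IsCriticalAt.smul hg ?_
  rwa [hα.adjointRep_inv]

end Action

/-! ### Orbits through critical points are geodesics -/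

section Orbits

set_option maxSynthPendingDepth 3

variable {E : Type*} [NormedAddCommGroup E] [NormedSpace ℝ E]
  {F : Type*} [NormedAddCommGroup F] [NormedSpace ℝ F]
  {G : Type*} [TopologicalSpace G] [ChartedSpace E G] [Group G]
  {M : Type*} [TopologicalSpace M] [ChartedSpace F M] [MulAction G M]

variable (F) in
/-- The flow `(t, p) ↦ α t • p` in the preferred chart at `x`. -/
def chartFlow (α : ℝ → G) (x : M) (q : ℝ × F) : F :=
  extChartAt 𝓘(ℝ, F) x (α q.1 • (extChartAt 𝓘(ℝ, F) x).symm q.2)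

omit [TopologicalSpace G] in
theorem extChartAt_symm_chartFlow {α : ℝ → G} {x : M} {q : ℝ × F}
    (hq' : α q.1 • (extChartAt 𝓘(ℝ, F) x).symm q.2 ∈ (chartAt F x).source) :
    (extChartAt 𝓘(ℝ, F) x).symm (chartFlow F α x q)
      = α q.1 • (extChartAt 𝓘(ℝ, F) x).symm q.2 :=
  (extChartAt 𝓘(ℝ, F) x).left_inv (by rwa [extChartAt_source])

omit [TopologicalSpace G] in
theorem chartFlow_mem_target {α : ℝ → G} {x : M} {q : ℝ × F}
    (hq' : α q.1 • (extChartAt 𝓘(ℝ, F) x).symm q.2 ∈ (chartAt F x).source) :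
    chartFlow F α x q ∈ (extChartAt 𝓘(ℝ, F) x).target :=
  (extChartAt 𝓘(ℝ, F) x).map_source (by rwa [extChartAt_source])

variable [IsManifold 𝓘(ℝ, F) ∞ M] [ContMDiffSMul 𝓘(ℝ, E) 𝓘(ℝ, F) ∞ G M]

theorem contMDiffAt_smul_extChartAt_symm {α : ℝ → G} (hα : ContMDiff 𝓘(ℝ, ℝ) 𝓘(ℝ, E) ∞ α) {x : M}
    {q : ℝ × F} (hq : q.2 ∈ (extChartAt 𝓘(ℝ, F) x).target) :
    ContMDiffAt 𝓘(ℝ, ℝ × F) 𝓘(ℝ, F) ∞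
      (fun r : ℝ × F => α r.1 • (extChartAt 𝓘(ℝ, F) x).symm r.2) q := by
  have h1 : ContMDiffAt 𝓘(ℝ, ℝ × F) 𝓘(ℝ, E) ∞ (fun r : ℝ × F => α r.1) q :=
    (hα q.1).comp q contDiff_fst.contMDiff.contMDiffAt
  have h2 : ContMDiffAt 𝓘(ℝ, F) 𝓘(ℝ, F) ∞ (extChartAt 𝓘(ℝ, F) x).symm q.2 :=
    (contMDiffOn_extChartAt_symm x).contMDiffAt ((isOpen_extChartAt_target x).mem_nhds hq)
  have h3 : ContMDiffAt 𝓘(ℝ, ℝ × F) 𝓘(ℝ, F) ∞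
      (fun r : ℝ × F => (extChartAt 𝓘(ℝ, F) x).symm r.2) q :=
    h2.comp q contDiff_snd.contMDiff.contMDiffAt
  exact (contMDiff_action E F G M).contMDiffAt.comp q (h1.prodMk h3)

theorem contDiffAt_chartFlow {α : ℝ → G} (hα : ContMDiff 𝓘(ℝ, ℝ) 𝓘(ℝ, E) ∞ α) {x : M}
    {q : ℝ × F} (hq : q.2 ∈ (extChartAt 𝓘(ℝ, F) x).target)
    (hq' : α q.1 • (extChartAt 𝓘(ℝ, F) x).symm q.2 ∈ (chartAt F x).source) :
    ContDiffAt ℝ ∞ (chartFlow F α x) q :=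
  ((contMDiffAt_extChartAt' hq').comp q (contMDiffAt_smul_extChartAt_symm hα hq)).contDiffAt

theorem eventually_chartFlow {α : ℝ → G} (hα : ContMDiff 𝓘(ℝ, ℝ) 𝓘(ℝ, E) ∞ α) {x : M}
    {q : ℝ × F} (hq : q.2 ∈ (extChartAt 𝓘(ℝ, F) x).target)
    (hq' : α q.1 • (extChartAt 𝓘(ℝ, F) x).symm q.2 ∈ (chartAt F x).source) :
    ∀ᶠ r in 𝓝 q, r.2 ∈ (extChartAt 𝓘(ℝ, F) x).target ∧
      α r.1 • (extChartAt 𝓘(ℝ, F) x).symm r.2 ∈ (chartAt F x).source := by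
  have h1 := (contMDiffAt_smul_extChartAt_symm hα hq).continuousAt
  exact (continuousAt_snd.eventually_mem ((isOpen_extChartAt_target x).mem_nhds hq)).and
    (h1.eventually_mem ((chartAt F x).open_source.mem_nhds hq'))

/-- The chart carries the spatial derivative of the flow to the differential of the translation. -/
theorem mfderiv_symm_fderiv_chartFlow {α : ℝ → G} (hα : ContMDiff 𝓘(ℝ, ℝ) 𝓘(ℝ, E) ∞ α) {x : M}
    {q : ℝ × F} (hq : q.2 ∈ (extChartAt 𝓘(ℝ, F) x).target)
    (hq' : α q.1 • (extChartAt 𝓘(ℝ, F) x).symm q.2 ∈ (chartAt F x).source) (u : F) :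
    (mfderiv 𝓘(ℝ, F) 𝓘(ℝ, F) (extChartAt 𝓘(ℝ, F) x).symm (chartFlow F α x q) : F →L[ℝ] F)
        (fderiv ℝ (chartFlow F α x) q (0, u))
      = (mfderiv 𝓘(ℝ, F) 𝓘(ℝ, F) (fun p : M => α q.1 • p) ((extChartAt 𝓘(ℝ, F) x).symm q.2) :
          F →L[ℝ] F)
        ((mfderiv 𝓘(ℝ, F) 𝓘(ℝ, F) (extChartAt 𝓘(ℝ, F) x).symm q.2 : F →L[ℝ] F) u) := by
  have hΦ := (contDiffAt_chartFlow hα hq hq').differentiableAt (by simp)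
  have hι : HasFDerivAt (fun y : F => (q.1, y)) (ContinuousLinearMap.inr ℝ ℝ F) q.2 :=
    hasFDerivAt_prodMk_right q.1 q.2
  have h1 : HasFDerivAt (fun y : F => chartFlow F α x (q.1, y))
      ((fderiv ℝ (chartFlow F α x) q).comp (ContinuousLinearMap.inr ℝ ℝ F)) q.2 :=
    HasFDerivAt.comp (f := fun y : F => (q.1, y)) q.2 hΦ.hasFDerivAt hι
  have h2 := mfderiv_comp_model (E := F) (E' := F) (E'' := F) (x := q.2) (y := chartFlow F α x q)
    (h := (extChartAt 𝓘(ℝ, F) x).symm) (f := fun y : F => chartFlow F α x (q.1, y)) rfl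
    (mdifferentiableAt_extChartAt_symm (chartFlow_mem_target hq'))
    h1.differentiableAt.mdifferentiableAt u
  have h3 : (mfderiv 𝓘(ℝ, F) 𝓘(ℝ, F) (fun y : F => chartFlow F α x (q.1, y)) q.2 : F →L[ℝ] F) u
      = fderiv ℝ (chartFlow F α x) q (0, u) := by
    rw [mfderiv_eq_fderiv, h1.fderiv]
    rfl
  have h4 := mfderiv_comp_model (E := F) (E' := F) (E'' := F) (x := q.2)
    (h := fun p : M => α q.1 • p) (f := (extChartAt 𝓘(ℝ, F) x).symm) rfl
    (mdifferentiable_translation E (α q.1) _) (mdifferentiableAt_extChartAt_symm hq) u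
  have h5 : (fun y : F => (extChartAt 𝓘(ℝ, F) x).symm (chartFlow F α x (q.1, y)))
      =ᶠ[𝓝 q.2] fun y => α q.1 • (extChartAt 𝓘(ℝ, F) x).symm y := by
    have hc : ContinuousAt (fun y : F => (q.1, y)) q.2 := by fun_prop
    filter_upwards [hc.eventually (eventually_chartFlow hα hq hq')] with y hy
    exact extChartAt_symm_chartFlow hy.2
  rw [h3] at h2
  refine h2.symm.trans (Eq.trans ?_ h4)
  rw [h5.mfderiv_eq]
  rfl

/-- The chart carries the time derivative of the flow to the fundamental vector field. -/
theorem mfderiv_symm_fderiv_chartFlow_time {X : GroupLieAlgebra 𝓘(ℝ, E) G} {α : ℝ → G}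
    (hα : IsOneParameterSubgroup X α) {x : M} {y : F} (hy : y ∈ (extChartAt 𝓘(ℝ, F) x).target) :
    (mfderiv 𝓘(ℝ, F) 𝓘(ℝ, F) (extChartAt 𝓘(ℝ, F) x).symm y : F →L[ℝ] F)
        (fderiv ℝ (chartFlow F α x) (0, y) (1, 0))
      = projDeriv E F G ((extChartAt 𝓘(ℝ, F) x).symm y) X := by
  have hq' : α ((0 : ℝ), y).1 • (extChartAt 𝓘(ℝ, F) x).symm ((0 : ℝ), y).2
      ∈ (chartAt F x).source := by
    simp only [hα.map_zero, one_smul]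
    rw [← extChartAt_source 𝓘(ℝ, F)]
    exact (extChartAt 𝓘(ℝ, F) x).map_target hy
  have h0 : chartFlow F α x (0, y) = y := by
    simp only [chartFlow, hα.map_zero, one_smul]
    exact (extChartAt 𝓘(ℝ, F) x).right_inv hy
  have hΦ := (contDiffAt_chartFlow hα.smooth (q := (0, y)) hy hq').differentiableAt (by simp)
  have hι : HasFDerivAt (fun t : ℝ => (t, y)) (ContinuousLinearMap.inl ℝ ℝ F) 0 :=
    hasFDerivAt_prodMk_left 0 y
  have h1 : HasFDerivAt (fun t : ℝ => chartFlow F α x (t, y))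
      ((fderiv ℝ (chartFlow F α x) (0, y)).comp (ContinuousLinearMap.inl ℝ ℝ F)) 0 :=
    HasFDerivAt.comp (f := fun t : ℝ => (t, y)) 0 hΦ.hasFDerivAt hι
  have h2 := mfderiv_comp_model (E := ℝ) (E' := F) (E'' := F) (x := (0 : ℝ)) (y := y)
    (h := (extChartAt 𝓘(ℝ, F) x).symm) (f := fun t : ℝ => chartFlow F α x (t, y)) h0
    (mdifferentiableAt_extChartAt_symm hy) h1.differentiableAt.mdifferentiableAt 1
  have h3 : (mfderiv 𝓘(ℝ, ℝ) 𝓘(ℝ, F) (fun t : ℝ => chartFlow F α x (t, y)) 0 : ℝ →L[ℝ] F) 1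
      = fderiv ℝ (chartFlow F α x) (0, y) (1, 0) := by
    rw [mfderiv_eq_fderiv, h1.fderiv]
    rfl
  have h5 : (fun t : ℝ => (extChartAt 𝓘(ℝ, F) x).symm (chartFlow F α x (t, y)))
      =ᶠ[𝓝 0] fun t => α t • (extChartAt 𝓘(ℝ, F) x).symm y := by
    have hc : ContinuousAt (fun t : ℝ => (t, y)) 0 := by fun_prop
    filter_upwards [hc.eventually (eventually_chartFlow hα.smooth hy hq')] with t ht
    exact extChartAt_symm_chartFlow ht.2
  refine (congrArg (mfderiv 𝓘(ℝ, F) 𝓘(ℝ, F) (extChartAt 𝓘(ℝ, F) x).symm y : F →L[ℝ] F)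
    h3).symm.trans ?_
  refine h2.symm.trans (Eq.trans ?_ (hα.mfderiv_smul_zero ((extChartAt 𝓘(ℝ, F) x).symm y)))
  rw [h5.mfderiv_eq]
  rfl

omit [IsManifold 𝓘(ℝ, F) ∞ M] [ContMDiffSMul 𝓘(ℝ, E) 𝓘(ℝ, F) ∞ G M] in
theorem IsOneParameterSubgroup.smul_symm_mem_source {X : GroupLieAlgebra 𝓘(ℝ, E) G} {α : ℝ → G}
    (hα : IsOneParameterSubgroup X α) {x : M} {y : F} (hy : y ∈ (extChartAt 𝓘(ℝ, F) x).target) :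
    α ((0 : ℝ), y).1 • (extChartAt 𝓘(ℝ, F) x).symm ((0 : ℝ), y).2 ∈ (chartAt F x).source := by
  simp only [hα.map_zero, one_smul]
  rw [← extChartAt_source 𝓘(ℝ, F)]
  exact (extChartAt 𝓘(ℝ, F) x).map_target hy

omit [IsManifold 𝓘(ℝ, F) ∞ M] [ContMDiffSMul 𝓘(ℝ, E) 𝓘(ℝ, F) ∞ G M] in
theorem IsOneParameterSubgroup.chartFlow_zero {X : GroupLieAlgebra 𝓘(ℝ, E) G} {α : ℝ → G}
    (hα : IsOneParameterSubgroup X α) {x : M} {y : F} (hy : y ∈ (extChartAt 𝓘(ℝ, F) x).target) :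
    chartFlow F α x (0, y) = y := by
  simp only [chartFlow, hα.map_zero, one_smul]
  exact (extChartAt 𝓘(ℝ, F) x).right_inv hy

theorem IsOneParameterSubgroup.fderiv_chartFlow_zero {X : GroupLieAlgebra 𝓘(ℝ, E) G} {α : ℝ → G}
    (hα : IsOneParameterSubgroup X α) {x : M} {y₀ : F} (hy : y₀ ∈ (extChartAt 𝓘(ℝ, F) x).target)
    (u : F) : fderiv ℝ (chartFlow F α x) (0, y₀) (0, u) = u := by
  have hΦ := contDiffAt_chartFlow hα.smooth (q := (0, y₀)) hy (hα.smul_symm_mem_source hy)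
  have h1 : HasFDerivAt (fun y : F => chartFlow F α x (0, y))
      ((fderiv ℝ (chartFlow F α x) (0, y₀)).comp (ContinuousLinearMap.inr ℝ ℝ F)) y₀ :=
    HasFDerivAt.comp (f := fun y : F => ((0 : ℝ), y)) y₀
      (hΦ.differentiableAt (by simp)).hasFDerivAt (hasFDerivAt_prodMk_right 0 y₀)
  have h2 : HasFDerivAt (fun y : F => chartFlow F α x (0, y)) (ContinuousLinearMap.id ℝ F) y₀ := by
    refine (hasFDerivAt_id y₀).congr_of_eventuallyEq ?_
    filter_upwards [(isOpen_extChartAt_target x).mem_nhds hy] with y hy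
    exact hα.chartFlow_zero hy
  simpa using DFunLike.congr_fun (h1.unique h2) u

/-- Since α(s) = α(s - t) α(t), the curve near time t is the flow started at its own position c t.
-/
theorem IsOneParameterSubgroup.hasDerivAt_chart {X : GroupLieAlgebra 𝓘(ℝ, E) G} {α : ℝ → G}
    (hα : IsOneParameterSubgroup X α) {x p : M} {t : ℝ} (ht : α t • p ∈ (chartAt F x).source) :
    HasDerivAt (fun s => extChartAt 𝓘(ℝ, F) x (α s • p))
      (fderiv ℝ (chartFlow F α x) (0, extChartAt 𝓘(ℝ, F) x (α t • p)) (1, 0)) t := by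
  set c : ℝ → F := fun s => extChartAt 𝓘(ℝ, F) x (α s • p) with hc
  have ht' : α t • p ∈ (extChartAt 𝓘(ℝ, F) x).source := by rwa [extChartAt_source]
  have hct : c t ∈ (extChartAt 𝓘(ℝ, F) x).target := (extChartAt 𝓘(ℝ, F) x).map_source ht'
  have hts : (extChartAt 𝓘(ℝ, F) x).symm (c t) = α t • p := (extChartAt 𝓘(ℝ, F) x).left_inv ht'
  have hΦt := (contDiffAt_chartFlow hα.smooth (q := (0, c t)) hct
    (hα.smul_symm_mem_source hct)).differentiableAt (by simp)
  have h1 : c = fun s => chartFlow F α x (s - t, c t) := by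
    funext s
    change extChartAt 𝓘(ℝ, F) x (α s • p)
      = extChartAt 𝓘(ℝ, F) x (α (s - t) • (extChartAt 𝓘(ℝ, F) x).symm (c t))
    rw [hts, smul_smul, ← hα.map_add, sub_add_cancel]
  have h2 : HasDerivAt (fun s : ℝ => (s - t, c t)) ((1 : ℝ), (0 : F)) t :=
    ((hasDerivAt_id t).sub_const t).prodMk (hasDerivAt_const _ _)
  have h3 : HasFDerivAt (chartFlow F α x) (fderiv ℝ (chartFlow F α x) (0, c t)) (t - t, c t) := by
    simp only [sub_self]
    exact hΦt.hasFDerivAt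
  have h4 := HasFDerivAt.comp_hasDerivAt (f := fun s : ℝ => (s - t, c t)) t h3 h2
  have h5 : (chartFlow F α x ∘ fun s : ℝ => (s - t, c t)) = c := h1.symm
  rwa [h5] at h4

variable {g : SmoothMetric F M}

/-- Supplies the invariance hypothesis of `geodesic_equation_of_isometric_flow`. -/
theorem chartForm_chartFlow (hg : IsInvariantMetric G g) {α : ℝ → G}
    (hα : ContMDiff 𝓘(ℝ, ℝ) 𝓘(ℝ, E) ∞ α) {x : M} {q : ℝ × F}
    (hq : q.2 ∈ (extChartAt 𝓘(ℝ, F) x).target)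
    (hq' : α q.1 • (extChartAt 𝓘(ℝ, F) x).symm q.2 ∈ (chartAt F x).source) (u v : F) :
    chartForm g x (chartFlow F α x q) (fderiv ℝ (chartFlow F α x) q (0, u))
      (fderiv ℝ (chartFlow F α x) q (0, v)) = chartForm g x q.2 u v := by
  let I : M → F →L[ℝ] F →L[ℝ] ℝ := fun p => g.inner p
  let D : F → F →L[ℝ] F := fun y => mfderiv 𝓘(ℝ, F) 𝓘(ℝ, F) (extChartAt 𝓘(ℝ, F) x).symm y
  -- Generalizing the base point and the vectors lets the equalities be substituted without
  -- transport between tangent spaces.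
  have key : ∀ (p : M) (a b a' b' : F), (extChartAt 𝓘(ℝ, F) x).symm (chartFlow F α x q) = p →
      D (chartFlow F α x q) a = a' → D (chartFlow F α x q) b = b' →
      chartForm g x (chartFlow F α x q) a b = I p a' b' := by
    rintro _ a b _ _ rfl rfl rfl
    rfl
  rw [key _ _ _ _ _ (extChartAt_symm_chartFlow hq') (mfderiv_symm_fderiv_chartFlow hα hq hq' u)
    (mfderiv_symm_fderiv_chartFlow hα hq hq' v)]
  exact hg (α q.1) ((extChartAt 𝓘(ℝ, F) x).symm q.2) (D q.2 u) (D q.2 v)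

theorem chartForm_fundamental {X : GroupLieAlgebra 𝓘(ℝ, E) G} {α : ℝ → G}
    (hα : IsOneParameterSubgroup X α) {x : M} {y : F} (hy : y ∈ (extChartAt 𝓘(ℝ, F) x).target) :
    chartForm g x y (fderiv ℝ (chartFlow F α x) (0, y) (1, 0))
      (fderiv ℝ (chartFlow F α x) (0, y) (1, 0))
      = fundamentalNormSq g X ((extChartAt 𝓘(ℝ, F) x).symm y) := by
  let I : F →L[ℝ] F →L[ℝ] ℝ := g.inner ((extChartAt 𝓘(ℝ, F) x).symm y)
  let D : F →L[ℝ] F := mfderiv 𝓘(ℝ, F) 𝓘(ℝ, F) (extChartAt 𝓘(ℝ, F) x).symm y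
  have key : ∀ a b : F, D a = b → chartForm g x y a a = I b b := by
    rintro a _ rfl
    rfl
  exact key _ _ (mfderiv_symm_fderiv_chartFlow_time hα hy)

variable [LieGroup 𝓘(ℝ, E) ∞ G]

theorem IsCriticalAt.fderiv_eq_zero {X : GroupLieAlgebra 𝓘(ℝ, E) G} {x p : M} {y : F}
    (hy : y ∈ (extChartAt 𝓘(ℝ, F) x).target) (hp : (extChartAt 𝓘(ℝ, F) x).symm y = p)
    (h : IsCriticalAt g X p) (w : F) :
    fderiv ℝ (fun z => fundamentalNormSq g X ((extChartAt 𝓘(ℝ, F) x).symm z)) y w = 0 := by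
  have h2 := mfderiv_comp_model (E := F) (E' := F) (E'' := ℝ) (x := y) (y := p)
    (h := fundamentalNormSq g X) (f := (extChartAt 𝓘(ℝ, F) x).symm) hp
    ((contMDiff_fundamentalNormSq g X).mdifferentiable (by simp) _)
    (mdifferentiableAt_extChartAt_symm hy) w
  rw [mfderiv_eq_fderiv] at h2
  exact h2.trans (h _)

variable [FiniteDimensional ℝ F]

/-- The orbit of a one-parameter group of isometries is a geodesic if the fundamental vector field
has critical norm at the initial point. -/
theorem IsCriticalAt.isGeodesicOn (hg : IsInvariantMetric G g) {X : GroupLieAlgebra 𝓘(ℝ, E) G}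
    {α : ℝ → G} (hα : IsOneParameterSubgroup X α) {p : M} (hp : IsCriticalAt g X p) :
    IsGeodesicOn g (fun t => α t • p) Set.univ := by
  have hsmooth : ContMDiff 𝓘(ℝ, ℝ) 𝓘(ℝ, F) ∞ (fun t => α t • p) :=
    (contMDiff_action E F G M).comp (hα.smooth.prodMk contMDiff_const)
  refine ⟨hsmooth.contMDiffOn, fun x t₀ _ hx w => ?_⟩
  have hx' : α t₀ • p ∈ (extChartAt 𝓘(ℝ, F) x).source := by rwa [extChartAt_source]
  obtain ⟨y₀, hy₀⟩ : ∃ y₀, y₀ = extChartAt 𝓘(ℝ, F) x (α t₀ • p) := ⟨_, rfl⟩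
  have hy : y₀ ∈ (extChartAt 𝓘(ℝ, F) x).target := hy₀ ▸ (extChartAt 𝓘(ℝ, F) x).map_source hx'
  have hsymm : (extChartAt 𝓘(ℝ, F) x).symm y₀ = α t₀ • p := by
    rw [hy₀]
    exact (extChartAt 𝓘(ℝ, F) x).left_inv hx'
  have hq' := hα.smul_symm_mem_source hy
  have hΦ := contDiffAt_chartFlow hα.smooth (q := (0, y₀)) hy hq'
  have hev := eventually_chartFlow hα.smooth (q := (0, y₀)) hy hq'
  have hinv : ∀ u v : F, ∀ᶠ t in 𝓝 (0 : ℝ), chartForm g x (chartFlow F α x (t, y₀))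
      (fderiv ℝ (chartFlow F α x) (t, y₀) (0, u)) (fderiv ℝ (chartFlow F α x) (t, y₀) (0, v))
      = chartForm g x y₀ u v := by
    intro u v
    have hcont : ContinuousAt (fun t : ℝ => (t, y₀)) 0 := by fun_prop
    filter_upwards [hcont.eventually hev] with t ht
    exact chartForm_chartFlow hg hα.smooth (q := (t, y₀)) ht.1 ht.2 u v
  have hcrit : ∀ w : F, fderiv ℝ (fun y => chartForm g x y
      (fderiv ℝ (chartFlow F α x) (0, y) (1, 0)) (fderiv ℝ (chartFlow F α x) (0, y) (1, 0))) y₀ w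
      = 0 := by
    intro w
    have h1 : (fun y => chartForm g x y (fderiv ℝ (chartFlow F α x) (0, y) (1, 0))
        (fderiv ℝ (chartFlow F α x) (0, y) (1, 0)))
        =ᶠ[𝓝 y₀] fun y => fundamentalNormSq g X ((extChartAt 𝓘(ℝ, F) x).symm y) := by
      filter_upwards [(isOpen_extChartAt_target x).mem_nhds hy] with y hy
      exact chartForm_fundamental hα hy
    rw [h1.fderiv_eq]
    exact (hp.smul_of_isOneParameterSubgroup hg hα t₀).fderiv_eq_zero hy hsymm w
  have hcurve : ∀ᶠ t in 𝓝 t₀, HasDerivAt (fun s => extChartAt 𝓘(ℝ, F) x (α s • p))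
      (fderiv ℝ (chartFlow F α x) (0, extChartAt 𝓘(ℝ, F) x (α t • p)) (1, 0)) t := by
    filter_upwards [(hsmooth t₀).continuousAt.eventually_mem
      ((chartAt F x).open_source.mem_nhds hx)] with t ht
    exact hα.hasDerivAt_chart ht
  exact geodesic_equation_of_isometric_flow (B := chartForm g x) (Φ := chartFlow F α x)
    ((contDiffAt_chartForm g hy).differentiableAt (by simp)) (chartForm_symm g y₀)
    (hΦ.of_le ENat.LEInfty.out) (hα.chartFlow_zero hy) hinv (hα.fderiv_chartFlow_zero hy) hcrit
    hy₀.symm hcurve w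

end Orbits

/-! ### The Lie bracket as the derivative of the adjoint representation -/

section FlatMultiplication

variable {E : Type*} [NormedAddCommGroup E] [NormedSpace ℝ E]

theorem hasFDerivAt_fderiv_left {μ : E × E → E} {e : E} (hμ : ContDiffAt ℝ 2 μ (e, e)) (a : E × E) :
    HasFDerivAt (fun x => fderiv ℝ μ (x, e) a)
      (((fderiv ℝ (fderiv ℝ μ) (e, e)).comp (ContinuousLinearMap.inl ℝ E E)).flip a) e := by
  have hD : DifferentiableAt ℝ (fderiv ℝ μ) (e, e) :=
    (hμ.fderiv_right (m := 1) (by norm_num)).differentiableAt (by norm_num)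
  have h1 : HasFDerivAt (fun x : E => fderiv ℝ μ (x, e))
      ((fderiv ℝ (fderiv ℝ μ) (e, e)).comp (ContinuousLinearMap.inl ℝ E E)) e :=
    HasFDerivAt.comp (f := fun x : E => (x, e)) e hD.hasFDerivAt (hasFDerivAt_prodMk_left e e)
  have := h1.clm_apply (hasFDerivAt_const a e)
  convert this using 1
  ext
  simp

theorem hasFDerivAt_fderiv_right {μ : E × E → E} {e : E} (hμ : ContDiffAt ℝ 2 μ (e, e))
    (a : E × E) :
    HasFDerivAt (fun x => fderiv ℝ μ (e, x) a)
      (((fderiv ℝ (fderiv ℝ μ) (e, e)).comp (ContinuousLinearMap.inr ℝ E E)).flip a) e := by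
  have hD : DifferentiableAt ℝ (fderiv ℝ μ) (e, e) :=
    (hμ.fderiv_right (m := 1) (by norm_num)).differentiableAt (by norm_num)
  have h1 : HasFDerivAt (fun x : E => fderiv ℝ μ (e, x))
      ((fderiv ℝ (fderiv ℝ μ) (e, e)).comp (ContinuousLinearMap.inr ℝ E E)) e :=
    HasFDerivAt.comp (f := fun x : E => (e, x)) e hD.hasFDerivAt (hasFDerivAt_prodMk_right e e)
  have := h1.clm_apply (hasFDerivAt_const a e)
  convert this using 1
  ext
  simp

/-- In flat coordinates: the derivative of the adjoint representation is the Lie bracket of left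
invariant vector fields. -/
theorem fderiv_eq_lieBracket_of_mul {μ : E × E → E} {e : E} (hμ : ContDiffAt ℝ 2 μ (e, e))
    (hid : ∀ u, fderiv ℝ μ (e, e) (0, u) = u) {X : E} {φ : E → E} (hφ : DifferentiableAt ℝ φ e)
    (hφe : φ e = X)
    (h : ∀ᶠ x in 𝓝 e, fderiv ℝ μ (x, e) (0, φ x) = fderiv ℝ μ (e, x) (X, 0)) (Y : E) :
    fderiv ℝ φ e Y = VectorField.lieBracket ℝ (fun x => fderiv ℝ μ (x, e) (0, X))
      (fun x => fderiv ℝ μ (x, e) (0, Y)) e := by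
  have hD : DifferentiableAt ℝ (fderiv ℝ μ) (e, e) :=
    (hμ.fderiv_right (m := 1) (by norm_num)).differentiableAt (by norm_num)
  have hs : ∀ a b, fderiv ℝ (fderiv ℝ μ) (e, e) a b = fderiv ℝ (fderiv ℝ μ) (e, e) b a :=
    fun a b => (hμ.isSymmSndFDerivAt (by simp)).eq a b
  have h1 : HasFDerivAt (fun x : E => fderiv ℝ μ (x, e))
      ((fderiv ℝ (fderiv ℝ μ) (e, e)).comp (ContinuousLinearMap.inl ℝ E E)) e :=
    HasFDerivAt.comp (f := fun x : E => (x, e)) e hD.hasFDerivAt (hasFDerivAt_prodMk_left e e)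
  have h2 := h1.clm_apply ((hasFDerivAt_const (0 : E) e).prodMk hφ.hasFDerivAt)
  -- Here φ(x) plays the role of Ad(x⁻¹)X, and `h` says that its left translate is the right
  -- translate of X. Both sides are differentiated at e: D²μ(0,Y)(X,0) = D²μ(Y,0)(0,X) + φ'(Y).
  have h3 := ((hasFDerivAt_fderiv_right hμ (X, 0)).congr_of_eventuallyEq h).unique h2
  have h4 := DFunLike.congr_fun h3 Y
  rw [VectorField.lieBracket_eq]
  simp only [(hasFDerivAt_fderiv_left hμ _).fderiv, hid]
  simp [hid, hφe] at h4 ⊢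
  rw [hs (X, 0) (0, Y), h4]
  abel

end FlatMultiplication

section Bracket

set_option maxSynthPendingDepth 3

variable {E : Type*} [NormedAddCommGroup E] [NormedSpace ℝ E]
  {G : Type*} [TopologicalSpace G] [ChartedSpace E G] [Group G]

variable (E G) in
/-- The multiplication in the preferred chart at `1`. -/
def chartMul (q : E × E) : E :=
  extChartAt 𝓘(ℝ, E) (1 : G) ((extChartAt 𝓘(ℝ, E) (1 : G)).symm q.1 *
    (extChartAt 𝓘(ℝ, E) (1 : G)).symm q.2)

variable [LieGroup 𝓘(ℝ, E) ∞ G]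

theorem contMDiffAt_symm_mul_symm {q : E × E} (h1 : q.1 ∈ (extChartAt 𝓘(ℝ, E) (1 : G)).target)
    (h2 : q.2 ∈ (extChartAt 𝓘(ℝ, E) (1 : G)).target) :
    ContMDiffAt 𝓘(ℝ, E × E) 𝓘(ℝ, E) ∞ (fun r : E × E =>
      (extChartAt 𝓘(ℝ, E) (1 : G)).symm r.1 * (extChartAt 𝓘(ℝ, E) (1 : G)).symm r.2) q := by
  have h : ∀ {y : E}, y ∈ (extChartAt 𝓘(ℝ, E) (1 : G)).target →
      ContMDiffAt 𝓘(ℝ, E) 𝓘(ℝ, E) ∞ (extChartAt 𝓘(ℝ, E) (1 : G)).symm y := fun hy =>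
    (contMDiffOn_extChartAt_symm 1).contMDiffAt ((isOpen_extChartAt_target 1).mem_nhds hy)
  have h3 : ContMDiffAt 𝓘(ℝ, E × E) 𝓘(ℝ, E) ∞
      (fun r : E × E => (extChartAt 𝓘(ℝ, E) (1 : G)).symm r.1) q :=
    (h h1).comp q contDiff_fst.contMDiff.contMDiffAt
  have h4 : ContMDiffAt 𝓘(ℝ, E × E) 𝓘(ℝ, E) ∞
      (fun r : E × E => (extChartAt 𝓘(ℝ, E) (1 : G)).symm r.2) q :=
    (h h2).comp q contDiff_snd.contMDiff.contMDiffAt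
  exact h3.mul h4

theorem contDiffAt_chartMul {q : E × E} (h1 : q.1 ∈ (extChartAt 𝓘(ℝ, E) (1 : G)).target)
    (h2 : q.2 ∈ (extChartAt 𝓘(ℝ, E) (1 : G)).target)
    (h : (extChartAt 𝓘(ℝ, E) (1 : G)).symm q.1 * (extChartAt 𝓘(ℝ, E) (1 : G)).symm q.2
      ∈ (chartAt E (1 : G)).source) : ContDiffAt ℝ ∞ (chartMul E G) q :=
  ((contMDiffAt_extChartAt' h).comp q (contMDiffAt_symm_mul_symm h1 h2)).contDiffAt

theorem eventually_chartMul {q : E × E} (h1 : q.1 ∈ (extChartAt 𝓘(ℝ, E) (1 : G)).target)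
    (h2 : q.2 ∈ (extChartAt 𝓘(ℝ, E) (1 : G)).target)
    (h : (extChartAt 𝓘(ℝ, E) (1 : G)).symm q.1 * (extChartAt 𝓘(ℝ, E) (1 : G)).symm q.2
      ∈ (chartAt E (1 : G)).source) :
    ∀ᶠ r in 𝓝 q, (extChartAt 𝓘(ℝ, E) (1 : G)).symm (chartMul E G r)
      = (extChartAt 𝓘(ℝ, E) (1 : G)).symm r.1 * (extChartAt 𝓘(ℝ, E) (1 : G)).symm r.2 := by
  filter_upwards [(contMDiffAt_symm_mul_symm h1 h2).continuousAt.eventually_mem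
    ((chartAt E (1 : G)).open_source.mem_nhds h)] with r hr
  exact (extChartAt 𝓘(ℝ, E) (1 : G)).left_inv (by rwa [extChartAt_source])

omit [LieGroup 𝓘(ℝ, E) ∞ G] in
theorem extChartAt_one_mem_target :
    extChartAt 𝓘(ℝ, E) (1 : G) 1 ∈ (extChartAt 𝓘(ℝ, E) (1 : G)).target :=
  mem_extChartAt_target 1

omit [LieGroup 𝓘(ℝ, E) ∞ G] in
theorem extChartAt_symm_one :
    (extChartAt 𝓘(ℝ, E) (1 : G)).symm (extChartAt 𝓘(ℝ, E) (1 : G) 1) = 1 :=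
  extChartAt_to_inv 1

theorem mfderiv_extChartAt_symm_one (u : E) :
    (mfderiv 𝓘(ℝ, E) 𝓘(ℝ, E) (extChartAt 𝓘(ℝ, E) (1 : G)).symm
      (extChartAt 𝓘(ℝ, E) (1 : G) 1) : E →L[ℝ] E) u = u := by
  have h := mfderivWithin_range_extChartAt_symm (I := 𝓘(ℝ, E)) (x := (1 : G))
  rw [modelWithCornersSelf_coe, Set.range_id, mfderivWithin_univ] at h
  exact congrArg (fun L : E →L[ℝ] E => L u) h

omit [LieGroup 𝓘(ℝ, E) ∞ G] in
theorem symm_mul_one_mem_source {x : E} (hx : x ∈ (extChartAt 𝓘(ℝ, E) (1 : G)).target) :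
    (extChartAt 𝓘(ℝ, E) (1 : G)).symm x
      * (extChartAt 𝓘(ℝ, E) (1 : G)).symm (extChartAt 𝓘(ℝ, E) (1 : G) 1)
      ∈ (chartAt E (1 : G)).source := by
  rw [extChartAt_symm_one, mul_one, ← extChartAt_source 𝓘(ℝ, E)]
  exact (extChartAt 𝓘(ℝ, E) (1 : G)).map_target hx

omit [LieGroup 𝓘(ℝ, E) ∞ G] in
theorem symm_one_mul_mem_source {x : E} (hx : x ∈ (extChartAt 𝓘(ℝ, E) (1 : G)).target) :
    (extChartAt 𝓘(ℝ, E) (1 : G)).symm (extChartAt 𝓘(ℝ, E) (1 : G) 1)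
      * (extChartAt 𝓘(ℝ, E) (1 : G)).symm x ∈ (chartAt E (1 : G)).source := by
  rw [extChartAt_symm_one, one_mul, ← extChartAt_source 𝓘(ℝ, E)]
  exact (extChartAt 𝓘(ℝ, E) (1 : G)).map_target hx

/-- The chart carries the derivative of the multiplication in the second variable to a left
invariant vector field. -/
theorem mfderiv_symm_fderiv_chartMul_right {x : E}
    (hx : x ∈ (extChartAt 𝓘(ℝ, E) (1 : G)).target) (u : E) :
    (mfderiv 𝓘(ℝ, E) 𝓘(ℝ, E) (extChartAt 𝓘(ℝ, E) (1 : G)).symm x : E →L[ℝ] E)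
        (fderiv ℝ (chartMul E G) (x, extChartAt 𝓘(ℝ, E) (1 : G) 1) (0, u))
      = (mfderiv 𝓘(ℝ, E) 𝓘(ℝ, E)
        (fun b : G => (extChartAt 𝓘(ℝ, E) (1 : G)).symm x * b) 1 : E →L[ℝ] E) u := by
  have he := extChartAt_one_mem_target (E := E) (G := G)
  have he' := symm_mul_one_mem_source hx
  set e : E := extChartAt 𝓘(ℝ, E) (1 : G) 1
  have hμ := (contDiffAt_chartMul (q := (x, e)) hx he he').differentiableAt (by simp)
  have h0 : chartMul E G (x, e) = x := by
    change extChartAt 𝓘(ℝ, E) (1 : G) (_ * (extChartAt 𝓘(ℝ, E) (1 : G)).symm e) = x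
    rw [extChartAt_symm_one, mul_one]
    exact (extChartAt 𝓘(ℝ, E) (1 : G)).right_inv hx
  have h1 : HasFDerivAt (fun y : E => chartMul E G (x, y))
      ((fderiv ℝ (chartMul E G) (x, e)).comp (ContinuousLinearMap.inr ℝ E E)) e :=
    HasFDerivAt.comp (f := fun y : E => (x, y)) e hμ.hasFDerivAt (hasFDerivAt_prodMk_right x e)
  have h2 := mfderiv_comp_model (E := E) (E' := E) (E'' := E) (x := e) (y := x)
    (h := (extChartAt 𝓘(ℝ, E) (1 : G)).symm) (f := fun y : E => chartMul E G (x, y)) h0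
    (mdifferentiableAt_extChartAt_symm hx) h1.differentiableAt.mdifferentiableAt u
  have h3 : (mfderiv 𝓘(ℝ, E) 𝓘(ℝ, E) (fun y : E => chartMul E G (x, y)) e : E →L[ℝ] E) u
      = fderiv ℝ (chartMul E G) (x, e) (0, u) := by
    rw [mfderiv_eq_fderiv, h1.fderiv]
    rfl
  have h4 := mfderiv_comp_model (E := E) (E' := E) (E'' := E) (x := e) (y := (1 : G))
    (h := fun b : G => (extChartAt 𝓘(ℝ, E) (1 : G)).symm x * b)
    (f := (extChartAt 𝓘(ℝ, E) (1 : G)).symm) extChartAt_symm_one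
    (mdifferentiable_mul_left' _ _) (mdifferentiableAt_extChartAt_symm he) u
  have h5 : (fun y : E => (extChartAt 𝓘(ℝ, E) (1 : G)).symm (chartMul E G (x, y)))
      =ᶠ[𝓝 e] fun y => (extChartAt 𝓘(ℝ, E) (1 : G)).symm x
        * (extChartAt 𝓘(ℝ, E) (1 : G)).symm y := by
    have hc : ContinuousAt (fun y : E => (x, y)) e := by fun_prop
    exact hc.eventually (eventually_chartMul hx he he')
  rw [mfderiv_extChartAt_symm_one] at h4
  refine (congrArg (mfderiv 𝓘(ℝ, E) 𝓘(ℝ, E) (extChartAt 𝓘(ℝ, E) (1 : G)).symm x : E →L[ℝ] E)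
    h3).symm.trans ?_
  refine h2.symm.trans (Eq.trans ?_ h4)
  rw [h5.mfderiv_eq]
  rfl

theorem mdifferentiable_mul_right' (a : G) :
    MDifferentiable 𝓘(ℝ, E) 𝓘(ℝ, E) (fun b : G => b * a) :=
  (contMDiff_mul_right (I := 𝓘(ℝ, E)) (n := ∞)).mdifferentiable (by simp)

/-- The chart carries the derivative of the multiplication in the first variable to a right
invariant vector field. -/
theorem mfderiv_symm_fderiv_chartMul_left {x : E}
    (hx : x ∈ (extChartAt 𝓘(ℝ, E) (1 : G)).target) (u : E) :
    (mfderiv 𝓘(ℝ, E) 𝓘(ℝ, E) (extChartAt 𝓘(ℝ, E) (1 : G)).symm x : E →L[ℝ] E)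
        (fderiv ℝ (chartMul E G) (extChartAt 𝓘(ℝ, E) (1 : G) 1, x) (u, 0))
      = (mfderiv 𝓘(ℝ, E) 𝓘(ℝ, E)
        (fun b : G => b * (extChartAt 𝓘(ℝ, E) (1 : G)).symm x) 1 : E →L[ℝ] E) u := by
  have he := extChartAt_one_mem_target (E := E) (G := G)
  have he' := symm_one_mul_mem_source hx
  set e : E := extChartAt 𝓘(ℝ, E) (1 : G) 1
  have hμ := (contDiffAt_chartMul (q := (e, x)) he hx he').differentiableAt (by simp)
  have h0 : chartMul E G (e, x) = x := by
    change extChartAt 𝓘(ℝ, E) (1 : G) ((extChartAt 𝓘(ℝ, E) (1 : G)).symm e * _) = x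
    rw [extChartAt_symm_one, one_mul]
    exact (extChartAt 𝓘(ℝ, E) (1 : G)).right_inv hx
  have h1 : HasFDerivAt (fun y : E => chartMul E G (y, x))
      ((fderiv ℝ (chartMul E G) (e, x)).comp (ContinuousLinearMap.inl ℝ E E)) e :=
    HasFDerivAt.comp (f := fun y : E => (y, x)) e hμ.hasFDerivAt (hasFDerivAt_prodMk_left e x)
  have h2 := mfderiv_comp_model (E := E) (E' := E) (E'' := E) (x := e) (y := x)
    (h := (extChartAt 𝓘(ℝ, E) (1 : G)).symm) (f := fun y : E => chartMul E G (y, x)) h0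
    (mdifferentiableAt_extChartAt_symm hx) h1.differentiableAt.mdifferentiableAt u
  have h3 : (mfderiv 𝓘(ℝ, E) 𝓘(ℝ, E) (fun y : E => chartMul E G (y, x)) e : E →L[ℝ] E) u
      = fderiv ℝ (chartMul E G) (e, x) (u, 0) := by
    rw [mfderiv_eq_fderiv, h1.fderiv]
    rfl
  have h4 := mfderiv_comp_model (E := E) (E' := E) (E'' := E) (x := e) (y := (1 : G))
    (h := fun b : G => b * (extChartAt 𝓘(ℝ, E) (1 : G)).symm x)
    (f := (extChartAt 𝓘(ℝ, E) (1 : G)).symm) extChartAt_symm_one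
    (mdifferentiable_mul_right' _ _) (mdifferentiableAt_extChartAt_symm he) u
  have h5 : (fun y : E => (extChartAt 𝓘(ℝ, E) (1 : G)).symm (chartMul E G (y, x)))
      =ᶠ[𝓝 e] fun y => (extChartAt 𝓘(ℝ, E) (1 : G)).symm y
        * (extChartAt 𝓘(ℝ, E) (1 : G)).symm x := by
    have hc : ContinuousAt (fun y : E => (y, x)) e := by fun_prop
    exact hc.eventually (eventually_chartMul he hx he')
  rw [mfderiv_extChartAt_symm_one] at h4
  refine (congrArg (mfderiv 𝓘(ℝ, E) 𝓘(ℝ, E) (extChartAt 𝓘(ℝ, E) (1 : G)).symm x : E →L[ℝ] E)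
    h3).symm.trans ?_
  refine h2.symm.trans (Eq.trans ?_ h4)
  rw [h5.mfderiv_eq]
  rfl

end Bracket

section FlatAdjoint

variable {E : Type*} [NormedAddCommGroup E] [NormedSpace ℝ E] [CompleteSpace E]

/-- The differential of left translation is the identity at e, hence invertible nearby with
differentiable inverse, and φ is that inverse applied to a right translate. -/
theorem differentiableAt_of_mul {μ : E × E → E} {e : E} (hμ : ContDiffAt ℝ 2 μ (e, e))
    (hid : ∀ u, fderiv ℝ μ (e, e) (0, u) = u) {X : E} {φ : E → E}
    (h : ∀ᶠ x in 𝓝 e, fderiv ℝ μ (x, e) (0, φ x) = fderiv ℝ μ (e, x) (X, 0)) :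
    DifferentiableAt ℝ φ e := by
  have hD : DifferentiableAt ℝ (fderiv ℝ μ) (e, e) :=
    (hμ.fderiv_right (m := 1) (by norm_num)).differentiableAt (by norm_num)
  have h1 : DifferentiableAt ℝ (fun x : E => fderiv ℝ μ (x, e)) e :=
    DifferentiableAt.comp (f := fun x : E => (x, e)) e hD
      (hasFDerivAt_prodMk_left e e).differentiableAt
  set A : E → E →L[ℝ] E := fun x => (fderiv ℝ μ (x, e)).comp (ContinuousLinearMap.inr ℝ E E)
  have hA : DifferentiableAt ℝ A e := h1.clm_comp (differentiableAt_const _)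
  have hAe : A e = (ContinuousLinearEquiv.refl ℝ E : E →L[ℝ] E) := by
    ext u
    exact hid u
  have hinv : DifferentiableAt ℝ (fun x => (A x).inverse) e := by
    refine DifferentiableAt.comp (g := ContinuousLinearMap.inverse) e ?_ hA
    rw [hAe]
    exact (contDiffAt_map_inverse (n := 1) _).differentiableAt (by norm_num)
  refine (hinv.clm_apply (hasFDerivAt_fderiv_right hμ (X, 0)).differentiableAt).congr_of_eventuallyEq
    ?_
  have hev : ∀ᶠ x in 𝓝 e, A x ∈ Set.range ((↑) : (E ≃L[ℝ] E) → E →L[ℝ] E) :=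
    hA.continuousAt.eventually_mem (hAe ▸ ContinuousLinearEquiv.nhds _)
  filter_upwards [h, hev] with x hx hx'
  exact ((ContinuousLinearMap.IsInvertible.inverse_apply_eq hx').2 hx.symm).symm

end FlatAdjoint

section Bracket

set_option maxSynthPendingDepth 3

variable {E : Type*} [NormedAddCommGroup E] [NormedSpace ℝ E]
  {G : Type*} [TopologicalSpace G] [ChartedSpace E G] [Group G] [LieGroup 𝓘(ℝ, E) ∞ G]

/-- Differentiate a(a⁻¹ba) = ba at b = 1. -/
theorem mfderiv_mul_left_adjointRep_inv (a : G) (X : GroupLieAlgebra 𝓘(ℝ, E) G) :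
    (mfderiv 𝓘(ℝ, E) 𝓘(ℝ, E) (fun b : G => a * b) 1 : E →L[ℝ] E) (adjointRep a⁻¹ X)
      = (mfderiv 𝓘(ℝ, E) 𝓘(ℝ, E) (fun b : G => b * a) 1 : E →L[ℝ] E) X := by
  have h := mfderiv_comp_model (E := E) (E' := E) (E'' := E) (x := (1 : G)) (y := (1 : G))
    (h := fun b : G => a * b) (f := fun b : G => a⁻¹ * b * a⁻¹⁻¹) (by simp)
    (mdifferentiable_mul_left' a 1) (mdifferentiable_conj a⁻¹ 1) X
  have h1 : (fun b : G => a * (a⁻¹ * b * a⁻¹⁻¹)) = fun b => b * a := by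
    funext b
    group
  rw [h1] at h
  exact h.symm

/-- The bracket on the manifold is computed in the chart at 1, whose differential at 1 is the
identity; there left invariant fields become partial derivatives of the multiplication. -/
theorem bracket_eq_lieBracket_chartMul (X Y : GroupLieAlgebra 𝓘(ℝ, E) G) :
    (⁅X, Y⁆ : GroupLieAlgebra 𝓘(ℝ, E) G) = VectorField.lieBracket ℝ
      (fun x => fderiv ℝ (chartMul E G) (x, extChartAt 𝓘(ℝ, E) (1 : G) 1) (0, (X : E)))
      (fun x => fderiv ℝ (chartMul E G) (x, extChartAt 𝓘(ℝ, E) (1 : G) 1) (0, (Y : E)))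
      (extChartAt 𝓘(ℝ, E) (1 : G) 1) := by
  have key : ∀ Z : GroupLieAlgebra 𝓘(ℝ, E) G,
      (VectorField.mpullbackWithin 𝓘(ℝ, E) 𝓘(ℝ, E) (extChartAt 𝓘(ℝ, E) (1 : G)).symm
        (mulInvariantVectorField Z) (Set.range 𝓘(ℝ, E)) : E → E)
      =ᶠ[𝓝 (extChartAt 𝓘(ℝ, E) (1 : G) 1)]
      fun x => fderiv ℝ (chartMul E G) (x, extChartAt 𝓘(ℝ, E) (1 : G) 1) (0, (Z : E)) := by
    intro Z
    filter_upwards [(isOpen_extChartAt_target (I := 𝓘(ℝ, E)) (1 : G)).mem_nhds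
      extChartAt_one_mem_target] with x hx
    have h1 := isInvertible_mfderivWithin_extChartAt_symm (I := 𝓘(ℝ, E)) hx
    rw [VectorField.mpullbackWithin_apply]
    refine h1.inverse_apply_eq.2 ?_
    rw [modelWithCornersSelf_coe, Set.range_id, mfderivWithin_univ]
    exact (mfderiv_symm_fderiv_chartMul_right hx Z).symm
  have h2 : (mfderiv 𝓘(ℝ, E) 𝓘(ℝ, E) (extChartAt 𝓘(ℝ, E) (1 : G)) 1 : E →L[ℝ] E)
      = ContinuousLinearMap.id ℝ E :=
    mfderiv_extChartAt_self (I := 𝓘(ℝ, E)) (x := (1 : G))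
  rw [GroupLieAlgebra.bracket_def, VectorField.mlieBracket, VectorField.mlieBracketWithin_apply,
    Set.preimage_univ, Set.univ_inter, modelWithCornersSelf_coe, Set.range_id]
  have h3 : ∀ v : E, (mfderiv 𝓘(ℝ, E) 𝓘(ℝ, E) (extChartAt 𝓘(ℝ, E) (1 : G)) 1).inverse v = v :=
    fun v => (isInvertible_mfderiv_extChartAt (mem_extChartAt_source 1)).inverse_apply_eq.2
      (congrArg (fun L : E →L[ℝ] E => L v) h2).symm
  refine (h3 _).trans ?_
  have hX := key X
  have hY := key Y
  rw [modelWithCornersSelf_coe, Set.range_id] at hX hY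
  exact (congrFun (VectorField.lieBracketWithin_univ (𝕜 := ℝ) (E := E)) _).trans (hX.lieBracket_vectorField_eq hY)

theorem fderiv_chartMul_one (u : E) : fderiv ℝ (chartMul E G)
    (extChartAt 𝓘(ℝ, E) (1 : G) 1, extChartAt 𝓘(ℝ, E) (1 : G) 1) (0, u) = u := by
  have h := mfderiv_symm_fderiv_chartMul_right (G := G) extChartAt_one_mem_target u
  rw [mfderiv_extChartAt_symm_one, extChartAt_symm_one] at h
  exact h.trans (mulInvariantVectorField_one' (G := G) u)

theorem eventually_fderiv_chartMul_adjointRep (X : GroupLieAlgebra 𝓘(ℝ, E) G) :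
    ∀ᶠ x in 𝓝 (extChartAt 𝓘(ℝ, E) (1 : G) 1),
      fderiv ℝ (chartMul E G) (x, extChartAt 𝓘(ℝ, E) (1 : G) 1)
        (0, (adjointRep ((extChartAt 𝓘(ℝ, E) (1 : G)).symm x)⁻¹ X : E))
      = fderiv ℝ (chartMul E G) (extChartAt 𝓘(ℝ, E) (1 : G) 1, x) ((X : E), 0) := by
  filter_upwards [(isOpen_extChartAt_target (I := 𝓘(ℝ, E)) (1 : G)).mem_nhds
    extChartAt_one_mem_target] with x hx
  apply mfderiv_extChartAt_symm_injective hx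
  exact (mfderiv_symm_fderiv_chartMul_right hx _).trans
    ((mfderiv_mul_left_adjointRep_inv ((extChartAt 𝓘(ℝ, E) (1 : G)).symm x) X).trans (mfderiv_symm_fderiv_chartMul_left hx X).symm)

variable [CompleteSpace E]

/-- The derivative of the adjoint representation at `1` is the Lie bracket. -/
theorem hasFDerivAt_adjointRep_inv (X : GroupLieAlgebra 𝓘(ℝ, E) G) :
    ∃ L : E →L[ℝ] E, HasFDerivAt (fun x : E =>
        (adjointRep ((extChartAt 𝓘(ℝ, E) (1 : G)).symm x)⁻¹ X : E)) L
        (extChartAt 𝓘(ℝ, E) (1 : G) 1) ∧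
      ∀ Y : GroupLieAlgebra 𝓘(ℝ, E) G, L Y = (⁅X, Y⁆ : GroupLieAlgebra 𝓘(ℝ, E) G) := by
  have he := extChartAt_one_mem_target (E := E) (G := G)
  have hμ : ContDiffAt ℝ 2 (chartMul E G)
      (extChartAt 𝓘(ℝ, E) (1 : G) 1, extChartAt 𝓘(ℝ, E) (1 : G) 1) :=
    (contDiffAt_chartMul he he (symm_mul_one_mem_source he)).of_le ENat.LEInfty.out
  have hev := eventually_fderiv_chartMul_adjointRep (G := G) X
  have hd := differentiableAt_of_mul hμ fderiv_chartMul_one hev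
  refine ⟨_, hd.hasFDerivAt, fun Y => ?_⟩
  rw [bracket_eq_lieBracket_chartMul]
  refine fderiv_eq_lieBracket_of_mul hμ fderiv_chartMul_one hd ?_ hev Y
  rw [extChartAt_symm_one, inv_one, adjointRep_one_apply]

end Bracket

/-! ### Derivative of the norm of a Killing field -/

section GeodesicVectors

set_option maxSynthPendingDepth 3

variable {E : Type*} [NormedAddCommGroup E] [NormedSpace ℝ E] [CompleteSpace E]
  {F : Type*} [NormedAddCommGroup F] [NormedSpace ℝ F]
  {G : Type*} [TopologicalSpace G] [ChartedSpace E G] [Group G] [LieGroup 𝓘(ℝ, E) ∞ G]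
  {M : Type*} [TopologicalSpace M] [ChartedSpace F M] [IsManifold 𝓘(ℝ, F) ∞ M] [MulAction G M]
  [ContMDiffSMul 𝓘(ℝ, E) 𝓘(ℝ, F) ∞ G M] {g : SmoothMetric F M}

/-- The derivative of the squared norm of a Killing field along another one. -/
theorem mfderiv_fundamentalNormSq_projDeriv (hg : IsInvariantMetric G g)
    (X Y : GroupLieAlgebra 𝓘(ℝ, E) G) (p : M) :
    (mfderiv 𝓘(ℝ, F) 𝓘(ℝ, ℝ) (fundamentalNormSq g X) p : F →L[ℝ] ℝ) (projDeriv E F G p Y)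
      = 2 * g.inner p (projDeriv E F G p ⁅X, Y⁆) (projDeriv E F G p X) := by
  have he := extChartAt_one_mem_target (E := E) (G := G)
  have hs := mdifferentiableAt_extChartAt_symm he
  obtain ⟨L, hL, hL'⟩ := hasFDerivAt_adjointRep_inv X
  let B : F →L[ℝ] F →L[ℝ] ℝ := g.inner p
  let P : E →L[ℝ] F := projDeriv E F G p
  have h1 := mfderiv_comp_model (E := E) (E' := E) (E'' := F) (y := (1 : G))
    (h := fun a : G => a • p) extChartAt_symm_one (mdifferentiable_orbitMap p 1) hs Y
  replace h1 := h1.trans (congrArg P (mfderiv_extChartAt_symm_one (E := E) (G := G) Y))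
  have h2 := mfderiv_comp_model (E := E) (E' := F) (E'' := ℝ) (y := p)
    (h := fundamentalNormSq g X) (f := fun x => (extChartAt 𝓘(ℝ, E) (1 : G)).symm x • p)
    (x := extChartAt 𝓘(ℝ, E) (1 : G) 1)
    (by rw [extChartAt_symm_one, one_smul])
    ((contMDiff_fundamentalNormSq g X).mdifferentiable (by simp) p)
    ((mdifferentiable_orbitMap p _).comp _ hs) Y
  -- Along x ↦ x·p the norm is a fixed quadratic form evaluated at Ad(x⁻¹)X, so only the derivative
  -- of Ad contributes.
  have h3 : (fun x => fundamentalNormSq g X ((extChartAt 𝓘(ℝ, E) (1 : G)).symm x • p))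
      = fun x => B (P (adjointRep ((extChartAt 𝓘(ℝ, E) (1 : G)).symm x)⁻¹ X : E))
        (P (adjointRep ((extChartAt 𝓘(ℝ, E) (1 : G)).symm x)⁻¹ X : E)) := by
    funext x
    exact fundamentalNormSq_smul hg X _ p
  have h4 := P.hasFDerivAt.comp _ hL
  have h5 := (B.hasFDerivAt.comp _ h4).clm_apply h4
  have h6 : adjointRep ((extChartAt 𝓘(ℝ, E) (1 : G)).symm (extChartAt 𝓘(ℝ, E) (1 : G) 1))⁻¹ X
      = X := by
    rw [extChartAt_symm_one, inv_one, adjointRep_one_apply]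
  have h7 : (fderiv ℝ (fun x => fundamentalNormSq g X ((extChartAt 𝓘(ℝ, E) (1 : G)).symm x • p))
      (extChartAt 𝓘(ℝ, E) (1 : G) 1)) Y
      = B (P (adjointRep ((extChartAt 𝓘(ℝ, E) (1 : G)).symm
          (extChartAt 𝓘(ℝ, E) (1 : G) 1))⁻¹ X : E)) (P (L Y))
        + B (P (L Y)) (P (adjointRep ((extChartAt 𝓘(ℝ, E) (1 : G)).symm
          (extChartAt 𝓘(ℝ, E) (1 : G) 1))⁻¹ X : E)) := by
    rw [h3]
    exact congrArg (fun T : E →L[ℝ] ℝ => T Y) h5.fderiv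
  rw [h6, hL'] at h7
  rw [mfderiv_eq_fderiv] at h2
  have h8 : ∀ u v : F, B u v = B v u := fun u v => g.symm p u v
  rw [h8, ← two_mul] at h7
  refine Eq.trans ?_ h7
  refine Eq.trans ?_ h2.symm
  exact congrArg (mfderiv 𝓘(ℝ, F) 𝓘(ℝ, ℝ) (fundamentalNormSq g X) p : F →L[ℝ] ℝ) h1.symm

end GeodesicVectors

/-! ### Generalized Wallach spaces: the algebraic condition -/

theorem Submodule.exists_sum_of_mem_iSup {R V ι : Type*} [Semiring R] [AddCommMonoid V] [Module R V]
    [Fintype ι] {p : ι → Submodule R V} {x : V} (hx : x ∈ ⨆ i, p i) :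
    ∃ f : ι → V, (∀ i, f i ∈ p i) ∧ ∑ i, f i = x := by
  classical
  have h : x ∈ ⨆ i ∈ (Finset.univ : Finset ι), p i := by simpa using hx
  obtain ⟨μ, hμ⟩ := (Submodule.mem_iSup_finset_iff_exists_sum p x).1 h
  exact ⟨fun i => μ i, fun i => (μ i).2, hμ⟩

section Wallach

set_option maxSynthPendingDepth 3

variable {E : Type*} [NormedAddCommGroup E] [NormedSpace ℝ E] [CompleteSpace E]
  {F : Type*} [NormedAddCommGroup F] [NormedSpace ℝ F]
  {G : Type*} [TopologicalSpace G] [ChartedSpace E G] [Group G] [LieGroup 𝓘(ℝ, E) ∞ G]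
  {M : Type*} [TopologicalSpace M] [ChartedSpace F M] [IsManifold 𝓘(ℝ, F) ∞ M] [MulAction G M]

namespace GeneralizedWallachSpace

variable {o : M} (W : GeneralizedWallachSpace E F G o)

omit [IsManifold 𝓘(ℝ, F) ∞ M] in
theorem exists_decomposition (X : GroupLieAlgebra 𝓘(ℝ, E) G) :
    ∃ x₀ ∈ W.k, ∃ x : Fin 3 → GroupLieAlgebra 𝓘(ℝ, E) G, (∀ i, x i ∈ W.m i) ∧
      X = x₀ + ∑ i, x i := by
  have h : X ∈ ⨆ i, ![W.k, W.m 0, W.m 1, W.m 2] i := by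
    rw [W.isInternal.submodule_iSup_eq_top]
    trivial
  obtain ⟨f, hf, rfl⟩ := Submodule.exists_sum_of_mem_iSup h
  refine ⟨f 0, hf 0, fun i => f i.succ, fun i => ?_, Fin.sum_univ_succ f⟩
  have := hf i.succ
  fin_cases i <;> exact this

omit [IsManifold 𝓘(ℝ, F) ∞ M] in
-- The form B([x,y],z) is alternating, so only the set of indices matters: a repeated index is
-- killed by [𝔪ᵢ,𝔪ᵢ] ⊂ 𝔨 ⊥ 𝔪, and three distinct ones include the commuting pair.
theorem killingForm_bracket_eq_zero
    (hW : ∃ i j : Fin 3, i ≠ j ∧ ∀ x ∈ W.m i, ∀ y ∈ W.m j, ⁅x, y⁆ = 0) {i j k : Fin 3}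
    {x y z : GroupLieAlgebra 𝓘(ℝ, E) G} (hx : x ∈ W.m i) (hy : y ∈ W.m j) (hz : z ∈ W.m k) :
    killingForm ℝ (GroupLieAlgebra 𝓘(ℝ, E) G) ⁅x, y⁆ z = 0 := by
  obtain ⟨i₀, j₀, hne, h₀⟩ := hW
  have rot : ∀ a b c : GroupLieAlgebra 𝓘(ℝ, E) G,
      killingForm ℝ (GroupLieAlgebra 𝓘(ℝ, E) G) ⁅a, b⁆ c
        = killingForm ℝ (GroupLieAlgebra 𝓘(ℝ, E) G) ⁅b, c⁆ a := fun a b c => by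
    rw [LieModule.traceForm_apply_lie_apply, LieModule.traceForm_comm]
  have swap : ∀ a b c : GroupLieAlgebra 𝓘(ℝ, E) G,
      killingForm ℝ (GroupLieAlgebra 𝓘(ℝ, E) G) ⁅b, a⁆ c = 0 →
      killingForm ℝ (GroupLieAlgebra 𝓘(ℝ, E) G) ⁅a, b⁆ c = 0 := fun a b c h => by
    rw [← lie_skew, map_neg, LinearMap.neg_apply, h, neg_zero]
  have same : ∀ {l n : Fin 3} {a b c : GroupLieAlgebra 𝓘(ℝ, E) G}, a ∈ W.m l → b ∈ W.m l →
      c ∈ W.m n → killingForm ℝ (GroupLieAlgebra 𝓘(ℝ, E) G) ⁅a, b⁆ c = 0 := fun ha hb hc =>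
    W.orthogonal_k _ _ (W.bracket_mem _ _ ha _ hb) _ hc
  have zero : ∀ {a b : GroupLieAlgebra 𝓘(ℝ, E) G} (c), a ∈ W.m i₀ → b ∈ W.m j₀ →
      killingForm ℝ (GroupLieAlgebra 𝓘(ℝ, E) G) ⁅a, b⁆ c = 0 := fun c ha hb => by
    rw [h₀ _ ha _ hb, map_zero, LinearMap.zero_apply]
  -- Either an index repeats, or i₀ and j₀ occupy two of the three places, in one of six orders.
  have cases : ∀ i j k i₀ j₀ : Fin 3, i₀ ≠ j₀ → i = j ∨ j = k ∨ k = i ∨ (i = i₀ ∧ j = j₀) ∨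
      (j = i₀ ∧ i = j₀) ∨ (j = i₀ ∧ k = j₀) ∨ (k = i₀ ∧ j = j₀) ∨ (k = i₀ ∧ i = j₀) ∨
      (i = i₀ ∧ k = j₀) := by decide
  rcases cases i j k i₀ j₀ hne with rfl | rfl | rfl | ⟨rfl, rfl⟩ | ⟨rfl, rfl⟩ | ⟨rfl, rfl⟩ |
    ⟨rfl, rfl⟩ | ⟨rfl, rfl⟩ | ⟨rfl, rfl⟩
  · exact same hx hy hz
  · rw [rot]
    exact same hy hz hx
  · rw [rot, rot]
    exact same hz hx hy
  · exact zero z hx hy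
  · exact swap _ _ _ (zero z hy hx)
  · rw [rot]
    exact zero x hy hz
  · rw [rot]
    exact swap _ _ _ (zero x hz hy)
  · rw [rot, rot]
    exact zero y hz hx
  · rw [rot, rot]
    exact swap _ _ _ (zero y hx hz)

omit [IsManifold 𝓘(ℝ, F) ∞ M] in
-- The orbit of o under exp(tX) is constant.
theorem projDeriv_eq_zero [T2Space G] {X : GroupLieAlgebra 𝓘(ℝ, E) G} (hX : X ∈ W.k) :
    projDeriv E F G o X = 0 := by
  have := W.smooth_action
  have h := (isOneParameterSubgroup_lieExp X).mfderiv_smul_zero (F := F) o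
  have h1 : (fun t : ℝ => lieExp (t • X) • o) = fun _ => o := by
    funext t
    exact (W.mem_k X).1 hX t
  rw [h1, mfderiv_const] at h
  exact h.symm

omit [IsManifold 𝓘(ℝ, F) ∞ M] in
theorem exists_projDeriv_eq [T2Space G] (v : TangentSpace 𝓘(ℝ, F) o) :
    ∃ X ∈ ⨆ i, W.m i, projDeriv E F G o X = v := by
  obtain ⟨Y, rfl⟩ := W.submersive v
  obtain ⟨y₀, hy₀, y, hy, rfl⟩ := W.exists_decomposition Y
  refine ⟨∑ i, y i, Submodule.sum_mem _ fun i _ => Submodule.mem_iSup_of_mem i (hy i), ?_⟩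
  rw [map_add, W.projDeriv_eq_zero hy₀, zero_add]

variable {W}
variable {g : SmoothMetric F M} {l : Fin 3 → ℝ}

/-- The geodesic lemma for `𝔪`. -/
theorem IsDiagonalMetric.inner_bracket_eq_zero [T2Space G] (hg : W.IsDiagonalMetric g l)
    (hW : ∃ i j : Fin 3, i ≠ j ∧ ∀ x ∈ W.m i, ∀ y ∈ W.m j, ⁅x, y⁆ = 0)
    {X Y : GroupLieAlgebra 𝓘(ℝ, E) G} (hX : X ∈ ⨆ i, W.m i) (hY : Y ∈ ⨆ i, W.m i) :
    g.inner o (projDeriv E F G o ⁅X, Y⁆) (projDeriv E F G o X) = 0 := by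
  obtain ⟨x, hx, rfl⟩ := Submodule.exists_sum_of_mem_iSup hX
  obtain ⟨y, hy, rfl⟩ := Submodule.exists_sum_of_mem_iSup hY
  obtain ⟨z₀, hz₀, z, hz, hZ⟩ := W.exists_decomposition ⁅∑ i, x i, ∑ i, y i⁆
  -- Orthogonality of the summands isolates one component: B(zᵢ, xᵢ) = B([X,Y], xᵢ).
  have h : ∀ i, killingForm ℝ (GroupLieAlgebra 𝓘(ℝ, E) G) (z i) (x i) = 0 := by
    intro i
    have h1 : killingForm ℝ (GroupLieAlgebra 𝓘(ℝ, E) G) ⁅∑ i, x i, ∑ i, y i⁆ (x i) = 0 := by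
      simp only [lie_sum, sum_lie, map_sum, LinearMap.sum_apply]
      exact Finset.sum_eq_zero fun a _ => Finset.sum_eq_zero fun b _ =>
        W.killingForm_bracket_eq_zero hW (hx _) (hy _) (hx _)
    rw [hZ, map_add, LinearMap.add_apply, W.orthogonal_k _ _ hz₀ _ (hx i), zero_add, map_sum,
      LinearMap.sum_apply, Finset.sum_eq_single i
        (fun j _ hj => W.orthogonal _ _ hj _ (hz j) _ (hx i)) (by simp)] at h1
    exact h1
  rw [hZ, map_add, W.projDeriv_eq_zero hz₀, zero_add, hg.inner_eq z x hz hx]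
  simp [h]

theorem IsDiagonalMetric.isCriticalAt [T2Space G] (hg : W.IsDiagonalMetric g l)
    (hW : ∃ i j : Fin 3, i ≠ j ∧ ∀ x ∈ W.m i, ∀ y ∈ W.m j, ⁅x, y⁆ = 0)
    {X : GroupLieAlgebra 𝓘(ℝ, E) G} (hX : X ∈ ⨆ i, W.m i) : IsCriticalAt g X o := by
  have := W.smooth_action
  intro v
  obtain ⟨Y, hY, rfl⟩ := W.exists_projDeriv_eq v
  refine (mfderiv_fundamentalNormSq_projDeriv hg.invariant X Y o).trans ?_
  exact mul_eq_zero_of_right (2 : ℝ) (hg.inner_bracket_eq_zero hW hX hY)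

end GeneralizedWallachSpace

end Wallach

/-! ### Every geodesic is an orbit -/

section GeodesicOrbits

variable {E : Type*} [NormedAddCommGroup E] [NormedSpace ℝ E] [FiniteDimensional ℝ E]
  [CompleteSpace E]
  {F : Type*} [NormedAddCommGroup F] [NormedSpace ℝ F] [FiniteDimensional ℝ F]
  {G : Type*} [TopologicalSpace G] [T2Space G] [ChartedSpace E G] [Group G]
  [LieGroup 𝓘(ℝ, E) ∞ G]
  {M : Type*} [TopologicalSpace M] [T2Space M] [ChartedSpace F M] [IsManifold 𝓘(ℝ, F) ∞ M]
  [MulAction G M]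

omit [FiniteDimensional ℝ F] [T2Space M] in
theorem IsGeodesicOn.mono {g : SmoothMetric F M} {γ : ℝ → M} {J J' : Set ℝ}
    (h : IsGeodesicOn g γ J) (hJ : J' ⊆ J) : IsGeodesicOn g γ J' :=
  ⟨h.smooth.mono hJ, fun x t ht => h.equation x t (hJ ht)⟩

omit [IsManifold 𝓘(ℝ, F) ∞ M] [FiniteDimensional ℝ E] [CompleteSpace E] [FiniteDimensional ℝ F]
  [T2Space G] [T2Space M] in
-- The vector is carried to o by a⁻¹, represented there by X, and returned by Ad(a).
theorem exists_projDeriv_smul_eq [ContMDiffSMul 𝓘(ℝ, E) 𝓘(ℝ, F) ∞ G M] {o : M} (a : G) (v : F)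
    {S : Set (GroupLieAlgebra 𝓘(ℝ, E) G)}
    (h : ∀ u : TangentSpace 𝓘(ℝ, F) o, ∃ X ∈ S, projDeriv E F G o X = u) :
    ∃ X ∈ S, (projDeriv E F G (a • o) (adjointRep a X) : F) = v := by
  obtain ⟨X, hX, hX'⟩ := h ((mfderiv 𝓘(ℝ, F) 𝓘(ℝ, F) (fun q : M => a⁻¹ • q) (a • o) :
    F →L[ℝ] F) v)
  refine ⟨X, hX, ?_⟩
  rw [projDeriv_smul, adjointRep_inv_apply_self]
  have h1 := mfderiv_comp_model (E := F) (E' := F) (E'' := F) (x := a • o) (y := o)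
    (h := fun q : M => a • q) (f := fun q : M => a⁻¹ • q) (inv_smul_smul a o)
    (mdifferentiable_translation E a _) (mdifferentiable_translation E a⁻¹ _) v
  have h2 : (fun q : M => a • a⁻¹ • q) = id := by
    funext q
    simp
  refine (congrArg (mfderiv 𝓘(ℝ, F) 𝓘(ℝ, F) (fun q : M => a • q) o : F →L[ℝ] F) hX').trans ?_
  refine h1.symm.trans ?_
  rw [h2]
  exact congrArg (fun L : F →L[ℝ] F => L v) mfderiv_id

omit [FiniteDimensional ℝ E] in
theorem IsCriticalAt.eqOn_geodesic [ContMDiffSMul 𝓘(ℝ, E) 𝓘(ℝ, F) ∞ G M] {g : SmoothMetric F M}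
    (hg : IsInvariantMetric G g) {X : GroupLieAlgebra 𝓘(ℝ, E) G} {p : M} (hp : IsCriticalAt g X p)
    {γ : ℝ → M} {J : Set ℝ} (hJ : IsOpen J) (hJ' : IsPreconnected J) (h0 : (0 : ℝ) ∈ J)
    (hγ : IsGeodesicOn g γ J) (hγ0 : γ 0 = p)
    (hv : mfderiv 𝓘(ℝ, ℝ) 𝓘(ℝ, F) γ 0 (1 : ℝ) = (projDeriv E F G p X : F)) :
    Set.EqOn γ (fun t => lieExp (t • X) • p) J := by
  have hα := isOneParameterSubgroup_lieExp X
  have hα0 : lieExp ((0 : ℝ) • X) • p = p := by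
    rw [hα.map_zero, one_smul]
  exact hγ.eqOn hJ hJ' ((hp.isGeodesicOn hg hα).mono (Set.subset_univ J)) h0 (hγ0.trans hα0.symm)
    (hv.trans (hα.mfderiv_smul_zero p).symm)

end GeodesicOrbits

end

theorem proposition4p3
    {E : Type*} [NormedAddCommGroup E] [NormedSpace ℝ E] [FiniteDimensional ℝ E] [CompleteSpace E]
    {F : Type*} [NormedAddCommGroup F] [NormedSpace ℝ F] [FiniteDimensional ℝ F]
    {G : Type*} [TopologicalSpace G] [T2Space G] [ChartedSpace E G] [Group G]
    [LieGroup 𝓘(ℝ, E) ∞ G]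
    {M : Type*} [TopologicalSpace M] [T2Space M] [ChartedSpace F M] [IsManifold 𝓘(ℝ, F) ∞ M]
    [MulAction G M] (o : M)
    (W : GeneralizedWallachSpace E F G o)
    (hW : ∃ i j : Fin 3, i ≠ j ∧ ∀ x ∈ W.m i, ∀ y ∈ W.m j, ⁅x, y⁆ = 0)
    (l₂ l₃ : ℝ) (hl₂ : 0 < l₂) (hl₃ : 0 < l₃)
    (g : SmoothMetric F M) (hg : W.IsDiagonalMetric g ![1, l₂, l₃]) :
    IsGeodesicOrbitSpace E G g ∧
    ∀ X ∈ ⨆ i, W.m i,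
      -- the curve `exp(tX) · o` is a geodesic through `o` with initial velocity `X`
      (IsGeodesicOn g (fun t : ℝ => lieExp (t • X) • o) Set.univ ∧
        lieExp ((0 : ℝ) • X) • o = o ∧
        mfderiv 𝓘(ℝ, ℝ) 𝓘(ℝ, F) (fun t : ℝ => lieExp (t • X) • o) 0 (1 : ℝ)
          = (projDeriv E F G o X : F)) ∧
      -- and every geodesic through `o` with initial velocity `X` is that curve
      ∀ (γ : ℝ → M) (J : Set ℝ), IsOpen J → IsPreconnected J → (0 : ℝ) ∈ J →
        IsGeodesicOn g γ J → γ 0 = o →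
        mfderiv 𝓘(ℝ, ℝ) 𝓘(ℝ, F) γ 0 (1 : ℝ) = (projDeriv E F G o X : F) →
        ∀ t ∈ J, γ t = lieExp (t • X) • o := by
  have := W.smooth_action
  have := W.transitive
  refine ⟨fun γ J hJ hJ' h0 hγ => ?_, fun X hX => ⟨⟨?_, ?_, ?_⟩, ?_⟩⟩
  -- By transitivity the geodesic starts at a·o; its generator is Ad(a)X with X ∈ 𝔪, which need not
  -- itself lie in 𝔪.
  · obtain ⟨a, ha⟩ := MulAction.exists_smul_eq G o (γ 0)
    obtain ⟨X, hX, hv⟩ := exists_projDeriv_smul_eq (E := E) (F := F) (S := ((⨆ i, W.m i : Submodule ℝ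
      (GroupLieAlgebra 𝓘(ℝ, E) G)) : Set (GroupLieAlgebra 𝓘(ℝ, E) G))) a
      (mfderiv 𝓘(ℝ, ℝ) 𝓘(ℝ, F) γ 0 (1 : ℝ) : F) W.exists_projDeriv_eq
    refine ⟨adjointRep a X, fun t ht => ?_⟩
    have hcrit : IsCriticalAt g (adjointRep a X) (a • o) := by
      refine IsCriticalAt.smul hg.invariant ?_
      rw [adjointRep_inv_apply_self]
      exact hg.isCriticalAt hW hX
    rw [hcrit.eqOn_geodesic hg.invariant hJ hJ' h0 hγ ha.symm hv.symm ht, ← ha]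
  · exact (hg.isCriticalAt hW hX).isGeodesicOn hg.invariant (isOneParameterSubgroup_lieExp X)
  · rw [(isOneParameterSubgroup_lieExp X).map_zero, one_smul]
  · exact (isOneParameterSubgroup_lieExp X).mfderiv_smul_zero o
  · intro γ J hJ hJ' h0 hγ hγ0 hv t ht
    exact (hg.isCriticalAt hW hX).eqOn_geodesic hg.invariant hJ hJ' h0 hγ hγ0 hv ht
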